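/- Let $d\ge 2$ and $\alpha_0\in(0,1)$, and write $\langle z\rangle=\sqrt{1+|z|^2}$. For $w\in C^\infty(\mathbf{R}^{d+1})$, written as a function of $(t,z)\in\mathbf{R}\times\mathbf{R}^d$, let $$X_wf(z,\zeta)=\int_{-\infty}^{\infty} f(z+t\zeta)\,w(t,z)\,\mathrm{d}t,\qquad \zeta\in S^{d-1},\ z\in\zeta^{\perp},$$ be the weighted X-ray transform, and for functions $F$ on $E=\bigcup_{\zeta\in S^{d-1}}\zeta^{\perp}$ let $$\|F\|_{L^2(E)}^2=\int_{S^{d-1}}\int_{\zeta^{\perp}}|F(z,\zeta)|^2\,\mathrm{d}z\,\mathrm{d}\zeta .$$ There exist constants $\varepsilon>0$ and $C>0$ and an integer $N\ge 0$, depending only on $d$ and $\alpha_0$, such that for every (complex-valued) weight $w\in C^\infty(\mathbf{R}^{d+1})$ with $$\sup_{t^2+\langle z\rangle^2\le 4\alpha_0^{-2}}\big|\partial^\beta\big(w(t,z)-1\big)\big|\le\varepsilon\qquad\text{for all multi-indices } |\beta|\le N,$$ and every $f\in L^2(\mathbf{R}^d)$ supported in the ball $B\big(0,(\alpha_0^{-2}-1)^{1/2}\big)$,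 one has $X_wf\in L^2(E)$ and $$\|f\|_{H^{-1/2}(\mathbf{R}^d)}\le C\,\|X_wf\|_{L^2(E)},$$ where $\|f\|_{H^{-1/2}(\mathbf{R}^d)}=\|(1-\Delta)^{-1/4}f\|_{L^2(\mathbf{R}^d)}$. -/

import Mathlib

open MeasureTheory Metric
open scoped ENNReal ContDiff FourierTransform

noncomputable section

namespace WeightedXray

/-- The Euclidean space `ℝ^d`. -/
abbrev Space (d : ℕ) : Type := EuclideanSpace ℝ (Fin d)

/-- The standard basis of `ℝ^{d+1} = ℝ_t × ℝ^d_z`: index `0` is the direction of `t`, index `i + 1`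
is the `i`-th coordinate direction of `z`. -/
def coordDir (d : ℕ) : Fin (d + 1) → ℝ × Space d :=
  Fin.cons ((1 : ℝ), (0 : Space d)) (fun i => ((0 : ℝ), EuclideanSpace.single i (1 : ℝ)))

/-- The mixed partial derivative `∂_{i_1} ⋯ ∂_{i_k} g` of order `k` at the point `p` of `ℝ^{d+1}`.
For a smooth function `g` the derivatives `∂^β g` with `|β| = k` are exactly these ones, `β` being
the multi-index that counts how often each coordinate occurs among `i_1, …, i_k`. -/
def mixedPartial {d k : ℕ} (i : Fin k → Fin (d + 1)) (g : ℝ × Space d → ℂ) (p : ℝ × Space d) : ℂ :=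
  iteratedFDeriv ℝ k g p (fun j => coordDir d (i j))

/-- The weighted X-ray transform `X_w f (z, ζ) = ∫ f (z + t ζ) w (t, z) dt`, for a unit vector `ζ`
and a vector `z` of the hyperplane `ζ^⊥`. -/
def xray {d : ℕ} (w : ℝ × Space d → ℂ) (f : Space d → ℂ)
    (ζ : sphere (0 : Space d) 1) (z : (ℝ ∙ (ζ : Space d))ᗮ) : ℂ :=
  ∫ t : ℝ, f ((z : Space d) + t • (ζ : Space d)) * w (t, (z : Space d))

/-- The norm of `L²(E)` (with values in `[0, ∞]`), where `E` is the bundle over the unit sphere with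
fibre the hyperplane `ζ^⊥` over `ζ`:
`‖F‖² = ∫_{S^{d-1}} ∫_{ζ^⊥} |F (z, ζ)|² dz dζ`, with `dζ` the surface measure of the sphere and `dz`
the Lebesgue measure of the hyperplane. -/
def bundleL2Norm {d : ℕ}
    (F : (ζ : sphere (0 : Space d) 1) → (ℝ ∙ (ζ : Space d))ᗮ → ℂ) : ℝ≥0∞ :=
  (∫⁻ ζ, (∫⁻ z : (ℝ ∙ (ζ : Space d))ᗮ, ‖F ζ z‖ₑ ^ 2)
    ∂(volume : Measure (Space d)).toSphere) ^ (1 / 2 : ℝ)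

/-- The norm `‖⟨D⟩^s f‖_{L²}` of `H^s(ℝ^d)` (with values in `[0, ∞]`) of a function `f` in
`L²(ℝ^d)`. Here `𝓕` is the Fourier transform on `L²` with kernel `exp (-2πi x·ξ)`, so that
`⟨D⟩ = (1 - Δ)^{1/2}` is multiplication by `(1 + |2πξ|²)^{1/2}` on the Fourier side. -/
def sobolevNorm {d : ℕ} (s : ℝ) (f : Lp ℂ 2 (volume : Measure (Space d))) : ℝ≥0∞ :=
  eLpNorm (fun ξ : Space d =>
    (((1 + (2 * Real.pi * ‖ξ‖) ^ 2) ^ (s / 2) : ℝ) : ℂ) * (𝓕 f : Lp ℂ 2 (volume : Measure (Space d))) ξ)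
    2 volume

end WeightedXray

end

/-! The argument is a direct energy estimate with damped ray integrals. For a unit vector `e` and `δ
> 0`, put `u_δ(x) = ∫_0^∞ exp(-δs) f(x + s e) ds`. Its Fourier multiplier is `(δ - 2πi e·ξ)⁻¹`, so
Plancherel gives `2δ ‖u_δ‖² = ∫ |𝓕 f|² P_δ(e·ξ)` with `P_δ` the Poisson kernel
(`lintegral_enorm_sq_rayLaplace`).

Unweighted bound: on a single line, `u_δ` before the support of `f` is a pure exponential times a
damped line integral, so `2δ ‖u_δ‖²` is at most the squared line integrals plus `O(δ) ‖f‖²`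
(`lintegral_poissonSymbol_le`). The spherical mean of `P_δ(ζ·ξ)` is at least `c ⟨2πξ⟩⁻¹` uniformly
in `δ ≤ 1` (`exists_le_lintegral_toSphere_poissonSymbol`). Letting `δ → 0` bounds the squared
`H^{-1/2}` norm by the squared norm of the unweighted transform (`mul_sobolev_le_xray`).

Perturbation: with `δ = 1`, the restriction `h` of `f` to a line satisfies `h = u - u'`. Integrating
by parts moves the derivative onto `v = w - 1`, so `|∫ h v|²` is `O(ε²) ‖u‖²` on that line as soon
as `v` and `∂_t v` are at most `ε` (`enorm_sq_integral_mul_le`). The mean of `P_1` is also at most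
`C ⟨2πξ⟩⁻¹` (`exists_lintegral_toSphere_poissonSymbol_one_le`), so the total error is `O(ε²)` times
the squared `H^{-1/2}` norm. It is absorbed for small `ε`; one derivative of `w` is enough. -/

/-! ### Elementary inequalities in `ℝ≥0∞` -/

theorem sq_lintegral_mul_le {α : Type*} [MeasurableSpace α] {μ : Measure α} {a b : α → ℝ≥0∞}
    (ha : AEMeasurable a μ) (hb : AEMeasurable b μ) :
    (∫⁻ x, a x * b x ∂μ) ^ 2 ≤ (∫⁻ x, a x ^ 2 ∂μ) * ∫⁻ x, b x ^ 2 ∂μ := by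
  have h := ENNReal.lintegral_mul_le_Lp_mul_Lq μ Real.HolderConjugate.two_two ha hb
  have h2 := pow_le_pow_left' h 2
  rw [mul_pow] at h2
  have key : ∀ x : ℝ≥0∞, (x ^ (1 / 2 : ℝ)) ^ 2 = x := fun x => by
    rw [← ENNReal.rpow_natCast, ← ENNReal.rpow_mul]; norm_num
  simpa only [key, ENNReal.rpow_two, Pi.mul_apply] using h2

theorem add_sq_le_two_mul (a b : ℝ≥0∞) : (a + b) ^ 2 ≤ 2 * a ^ 2 + 2 * b ^ 2 := by
  have h := ENNReal.rpow_add_le_mul_rpow_add_rpow a b (p := 2) (by norm_num)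
  norm_num at h
  simpa [mul_add] using h

theorem lintegral_enorm_sq {α : Type*} [MeasurableSpace α] (μ : Measure α) (g : α → ℂ) :
    ∫⁻ x, ‖g x‖ₑ ^ 2 ∂μ = eLpNorm g 2 μ ^ 2 := by
  simpa using (eLpNorm_nnreal_pow_eq_lintegral (f := g) (μ := μ) (p := 2) (by simp)).symm

/-! ### Fubini along parallel lines -/

section Fibre

variable {E : Type*} [NormedAddCommGroup E] [InnerProductSpace ℝ E] [FiniteDimensional ℝ E]
  [MeasurableSpace E] [BorelSpace E]

theorem measurePreserving_orthogonal_add_smul {e : E} (he : ‖e‖ = 1) :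
    MeasurePreserving (fun p : (ℝ ∙ e)ᗮ × ℝ => (p.1 : E) + p.2 • e)
      ((volume : Measure (ℝ ∙ e)ᗮ).prod volume) volume := by
  have h1 : MeasurePreserving (fun p : (ℝ ∙ e)ᗮ × ℝ =>
      ((LinearIsometryEquiv.toSpanUnitSingleton (𝕜 := ℝ) e he p.2, p.1) : (ℝ ∙ e) × (ℝ ∙ e)ᗮ))
      ((volume : Measure (ℝ ∙ e)ᗮ).prod volume) (volume.prod volume) :=
    ((LinearIsometryEquiv.toSpanUnitSingleton (𝕜 := ℝ) e he).measurePreserving.prod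
      (MeasurePreserving.id _)).comp Measure.measurePreserving_swap
  have h2 := (ℝ ∙ e).orthogonalDecomposition.symm.measurePreserving.comp
    ((WithLp.volume_preserving_toLp (ℝ ∙ e) (ℝ ∙ e)ᗮ).comp h1)
  convert! h2 using 1
  ext p
  simp [add_comm]

theorem lintegral_orthogonal_lintegral_line {e : E} (he : ‖e‖ = 1) {φ : E → ℝ≥0∞}
    (hφ : Measurable φ) :
    ∫⁻ z : (ℝ ∙ e)ᗮ, ∫⁻ t : ℝ, φ ((z : E) + t • e) = ∫⁻ x, φ x := by
  rw [← (measurePreserving_orthogonal_add_smul he).lintegral_comp hφ, lintegral_prod]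
  exact (hφ.comp (measurePreserving_orthogonal_add_smul he).measurable).aemeasurable

theorem ae_orthogonal_ae_line {e : E} (he : ‖e‖ = 1) {P : E → Prop}
    (h : ∀ᵐ x : E, P x) : ∀ᵐ z : (ℝ ∙ e)ᗮ, ∀ᵐ t : ℝ, P ((z : E) + t • e) :=
  Measure.ae_ae_of_ae_prod ((measurePreserving_orthogonal_add_smul he).quasiMeasurePreserving.ae h)

end Fibre

/-! ### The Fourier integral and the `L²` Fourier transform -/

section Fourier

variable {E : Type*} [NormedAddCommGroup E] [InnerProductSpace ℝ E] [FiniteDimensional ℝ E]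
  [MeasurableSpace E] [BorelSpace E]

/-- Both sides have the same pairing with every test function, because each transform can be moved
onto the test function. -/
theorem coeFn_fourier_toLp {f : E → ℂ} (hf : Integrable f) (hf2 : MemLp f 2) :
    (𝓕 (hf2.toLp f) : Lp ℂ 2 (volume : Measure E)) =ᵐ[volume] 𝓕 f := by
  refine ae_eq_of_integral_contDiff_smul_eq
    ((Lp.memLp _).locallyIntegrable (by norm_num)) ?_ ?_
  · exact (VectorFourier.fourierIntegral_continuous Real.continuous_fourierChar
      (by exact continuous_inner) hf).locallyIntegrable
  intro g hg hgc
  have hg₁ : HasCompactSupport (Complex.ofRealCLM ∘ g) := hgc.comp_left rfl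
  have hg₂ : ContDiff ℝ ∞ (Complex.ofRealCLM ∘ g) := by fun_prop
  set G : SchwartzMap E ℂ := hg₁.toSchwartzMap hg₂ with hG
  have hGg : ∀ x, G x = (g x : ℂ) := fun x => rfl
  have h1 := DFunLike.congr_fun (Lp.fourier_toTemperedDistribution_eq (hf2.toLp f)) G
  rw [TemperedDistribution.fourier_apply, Lp.toTemperedDistribution_apply,
    Lp.toTemperedDistribution_apply] at h1
  have h2 : ∫ x, 𝓕 f x • G x = ∫ x, f x • (𝓕 (G : E → ℂ)) x := by
    simpa using! VectorFourier.integral_fourierIntegral_smul_eq_flip (L := innerₗ E)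
      Real.continuous_fourierChar continuous_inner hf G.integrable
  calc ∫ x, g x • (𝓕 (hf2.toLp f) : Lp ℂ 2 (volume : Measure E)) x
      = ∫ x, G x • (𝓕 (hf2.toLp f) : Lp ℂ 2 (volume : Measure E)) x := by simp [hGg]
    _ = ∫ x, (𝓕 G) x • (hf2.toLp f) x := h1.symm
    _ = ∫ x, f x • (𝓕 (G : E → ℂ)) x := by
        refine integral_congr_ae ?_
        filter_upwards [hf2.coeFn_toLp] with x hx
        rw [hx, SchwartzMap.fourier_coe, smul_eq_mul, smul_eq_mul, mul_comm]
    _ = ∫ x, g x • 𝓕 f x := by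
        rw [← h2]; simp [hGg, mul_comm]

theorem lintegral_enorm_sq_fourier {f : E → ℂ} (hf : Integrable f) (hf2 : MemLp f 2) :
    ∫⁻ ξ, ‖𝓕 f ξ‖ₑ ^ 2 = ∫⁻ x, ‖f x‖ₑ ^ 2 := by
  have h : eLpNorm (𝓕 f) 2 volume = eLpNorm f 2 volume := by
    rw [← eLpNorm_congr_ae (coeFn_fourier_toLp hf hf2), ← eLpNorm_congr_ae hf2.coeFn_toLp,
      ← Lp.enorm_def, ← Lp.enorm_def, ← ofReal_norm, ← ofReal_norm, Lp.norm_fourier_eq]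
  rw [lintegral_enorm_sq, lintegral_enorm_sq, h]

end Fourier

/-! ### Orthogonal coordinates along a unit vector -/

section Inner

variable {E : Type*} [NormedAddCommGroup E] [InnerProductSpace ℝ E]

theorem exists_unit_smul_eq [Nontrivial E] (ξ : E) : ∃ e : E, ‖e‖ = 1 ∧ ξ = ‖ξ‖ • e := by
  by_cases h : ξ = 0
  · obtain ⟨e, he⟩ := exists_norm_eq E zero_le_one
    exact ⟨e, he, by simp [h]⟩
  · exact ⟨‖ξ‖⁻¹ • ξ, by simp [norm_smul, h], by simp [h]⟩

theorem norm_orthogonal_add_smul_sq {e : E} (he : ‖e‖ = 1) (z : (ℝ ∙ e)ᗮ) (t : ℝ) :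
    ‖(z : E) + t • e‖ ^ 2 = ‖z‖ ^ 2 + t ^ 2 := by
  have h : inner ℝ (z : E) (t • e) = 0 := by
    rw [real_inner_smul_right, real_inner_comm,
      Submodule.mem_orthogonal_singleton_iff_inner_right.1 z.2, mul_zero]
  rw [norm_add_sq_real, h, norm_smul, he]
  simp

theorem inner_orthogonal_add_smul {e : E} (he : ‖e‖ = 1) (z : (ℝ ∙ e)ᗮ) (t r : ℝ) :
    inner ℝ ((z : E) + t • e) (r • e) = t * r := by
  have h : inner ℝ (z : E) e = 0 := by
    rw [real_inner_comm, Submodule.mem_orthogonal_singleton_iff_inner_right.1 z.2]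
  rw [inner_add_left, real_inner_smul_left, real_inner_smul_right, real_inner_smul_right, h,
    real_inner_self_eq_norm_sq, he]
  ring

end Inner

/-! ### Spherical means of the Poisson kernel -/

section Sphere

variable {E : Type*} [NormedAddCommGroup E] [InnerProductSpace ℝ E] [FiniteDimensional ℝ E]
  [MeasurableSpace E] [BorelSpace E]

theorem lintegral_eq_lintegral_toSphere [Nontrivial E] {φ : E → ℝ≥0∞} (hφ : Measurable φ) :
    ∫⁻ x, φ x = ∫⁻ ζ : sphere (0 : E) 1, ∫⁻ r : Set.Ioi (0 : ℝ), φ ((r : ℝ) • (ζ : E))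
      ∂(Measure.volumeIoiPow (Module.finrank ℝ E - 1)) ∂(volume : Measure E).toSphere := by
  have hmp := (volume : Measure E).measurePreserving_homeomorphUnitSphereProd
  have hψ : Measurable fun p : sphere (0 : E) 1 × Set.Ioi (0 : ℝ) =>
      φ ((p.2 : ℝ) • (p.1 : E)) := by fun_prop
  rw [← lintegral_prod (fun p : sphere (0 : E) 1 × Set.Ioi (0 : ℝ) =>
      φ ((p.2 : ℝ) • (p.1 : E))) hψ.aemeasurable, ← hmp.lintegral_comp hψ]
  have h0 : ∀ x : ({0}ᶜ : Set E), (((homeomorphUnitSphereProd E x).2 : ℝ) •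
      ((homeomorphUnitSphereProd E x).1 : E)) = x := fun x =>
    congrArg Subtype.val ((homeomorphUnitSphereProd E).symm_apply_apply x)
  simp_rw [h0]
  rw [lintegral_subtype_comap (measurableSet_singleton (0 : E)).compl,
    restrict_compl_singleton]

/-- The Poisson kernel `τ ↦ 2δ / (δ² + (2πτ)²)`, the Fourier transform of `exp (-δ |t|)`. -/
noncomputable def poissonSymbol (δ τ : ℝ) : ℝ := 2 * δ / (δ ^ 2 + (2 * Real.pi * τ) ^ 2)

theorem measurable_poissonSymbol (δ : ℝ) : Measurable (poissonSymbol δ) := by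
  unfold poissonSymbol; fun_prop

theorem poissonSymbol_anti {δ : ℝ} (hδ : 0 < δ) {σ τ : ℝ} (h : |σ| ≤ |τ|) :
    poissonSymbol δ τ ≤ poissonSymbol δ σ := by
  unfold poissonSymbol
  have := sq_le_sq.2 h
  simp only [mul_pow]
  gcongr

omit [MeasurableSpace E] [BorelSpace E] in
theorem volumeIoiPow_Iio_one [Nontrivial E] :
    Measure.volumeIoiPow (Module.finrank ℝ E - 1) (Set.Iio ⟨1, Set.mem_Ioi.2 one_pos⟩)
      = (Module.finrank ℝ E : ℝ≥0∞)⁻¹ := by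
  have hpos : 0 < Module.finrank ℝ E := Module.finrank_pos
  rw [Measure.volumeIoiPow_apply_Iio, Nat.cast_pred hpos, sub_add_cancel, one_pow, one_div,
    ENNReal.ofReal_inv_of_pos (by exact_mod_cast hpos), ENNReal.ofReal_natCast]

/-- The kernel decreases in `|τ|`, so shrinking `ζ` to `rζ` with `r < 1` only increases it. In polar
coordinates the radial mass of the unit ball is the inverse of the dimension. A ball, unlike the
sphere, can be sliced into lines parallel to `ξ`. -/
theorem lintegral_toSphere_poissonSymbol_le [Nontrivial E] {δ : ℝ} (hδ : 0 < δ) (ξ : E) :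
    ∫⁻ ζ : sphere (0 : E) 1, ENNReal.ofReal (poissonSymbol δ (inner ℝ (ζ : E) ξ))
        ∂(volume : Measure E).toSphere
      ≤ Module.finrank ℝ E * ∫⁻ x in ball (0 : E) 1, ENNReal.ofReal
        (poissonSymbol δ (inner ℝ x ξ)) := by
  have hpos : 0 < Module.finrank ℝ E := Module.finrank_pos
  have hm := measurable_poissonSymbol δ
  have hm2 : Measurable fun x : E => ENNReal.ofReal (poissonSymbol δ (inner ℝ x ξ)) := by
    fun_prop
  rw [← lintegral_indicator measurableSet_ball,
    lintegral_eq_lintegral_toSphere (hm2.indicator measurableSet_ball)]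
  have hle : ∀ ζ : sphere (0 : E) 1,
      ENNReal.ofReal (poissonSymbol δ (inner ℝ (ζ : E) ξ)) * (Module.finrank ℝ E : ℝ≥0∞)⁻¹ ≤
      ∫⁻ r : Set.Ioi (0 : ℝ), (ball (0 : E) 1).indicator
        (fun x : E => ENNReal.ofReal (poissonSymbol δ (inner ℝ x ξ))) ((r : ℝ) • (ζ : E))
      ∂(Measure.volumeIoiPow (Module.finrank ℝ E - 1)) := by
    intro ζ
    rw [← volumeIoiPow_Iio_one (E := E), ← setLIntegral_const]
    refine (setLIntegral_mono_ae' measurableSet_Iio (.of_forall fun r hr => ?_)).trans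
      (setLIntegral_le_lintegral _ _)
    have hr0 : (0 : ℝ) < r := r.2
    have hr1 : (r : ℝ) < 1 := hr
    rw [Set.indicator_of_mem (by simp [norm_smul, abs_of_pos hr0, hr1])]
    refine ENNReal.ofReal_le_ofReal (poissonSymbol_anti hδ ?_)
    rw [real_inner_smul_left, abs_mul, abs_of_pos hr0]
    exact mul_le_of_le_one_left (abs_nonneg _) hr1.le
  calc _ = Module.finrank ℝ E * ∫⁻ ζ : sphere (0 : E) 1,
        ENNReal.ofReal (poissonSymbol δ (inner ℝ (ζ : E) ξ)) * (Module.finrank ℝ E : ℝ≥0∞)⁻¹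
          ∂(volume : Measure E).toSphere := by
        rw [lintegral_mul_const _ (by fun_prop), mul_left_comm, ENNReal.mul_inv_cancel
          (by exact_mod_cast hpos.ne') (by simp), mul_one]
    _ ≤ _ := by gcongr with ζ; exact hle ζ

/-- On the shell `r ≥ 1/2`, so `2r ≥ 1` and doubling the argument makes the kernel at `rζ` no larger
than at `ζ`; the radial mass is at most one. -/
theorem le_lintegral_toSphere_poissonSymbol [Nontrivial E] {δ : ℝ} (hδ : 0 < δ) (ξ : E) :
    ∫⁻ x in ball (0 : E) 1 \ ball 0 (1 / 2), ENNReal.ofReal (poissonSymbol δ (2 * inner ℝ x ξ))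
      ≤ ∫⁻ ζ : sphere (0 : E) 1, ENNReal.ofReal (poissonSymbol δ (inner ℝ (ζ : E) ξ))
        ∂(volume : Measure E).toSphere := by
  have hpos : 0 < Module.finrank ℝ E := Module.finrank_pos
  have hm := measurable_poissonSymbol δ
  have hm2 : Measurable fun x : E => ENNReal.ofReal (poissonSymbol δ (2 * inner ℝ x ξ)) := by
    fun_prop
  have hA : MeasurableSet (ball (0 : E) 1 \ ball 0 (1 / 2)) :=
    measurableSet_ball.diff measurableSet_ball
  rw [← lintegral_indicator hA, lintegral_eq_lintegral_toSphere (hm2.indicator hA)]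
  refine lintegral_mono fun ζ => ?_
  calc _ ≤ ∫⁻ r : Set.Ioi (0 : ℝ), (Set.Iio ⟨1, Set.mem_Ioi.2 one_pos⟩).indicator
        (fun _ => ENNReal.ofReal (poissonSymbol δ (inner ℝ (ζ : E) ξ))) r
        ∂(Measure.volumeIoiPow (Module.finrank ℝ E - 1)) := by
        refine lintegral_mono fun r => ?_
        have hr0 : (0 : ℝ) < r := r.2
        by_cases h : (r : ℝ) • (ζ : E) ∈ ball (0 : E) 1 \ ball 0 (1 / 2)
        · have h' : (r : ℝ) < 1 ∧ 1 / 2 ≤ (r : ℝ) := by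
            simpa [norm_smul, abs_of_pos hr0] using h
          rw [Set.indicator_of_mem h, Set.indicator_of_mem
            (show r ∈ Set.Iio (⟨1, Set.mem_Ioi.2 one_pos⟩ : Set.Ioi (0 : ℝ)) from h'.1)]
          refine ENNReal.ofReal_le_ofReal (poissonSymbol_anti hδ ?_)
          rw [real_inner_smul_left, abs_mul, abs_mul, abs_of_pos hr0, abs_two]
          nlinarith [abs_nonneg (inner ℝ (ζ : E) ξ)]
        · rw [Set.indicator_of_notMem h]; exact zero_le
    _ = ENNReal.ofReal (poissonSymbol δ (inner ℝ (ζ : E) ξ)) * (Module.finrank ℝ E : ℝ≥0∞)⁻¹ := by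
        rw [lintegral_indicator_const measurableSet_Iio, volumeIoiPow_Iio_one]
    _ ≤ ENNReal.ofReal (poissonSymbol δ (inner ℝ (ζ : E) ξ)) := by
        refine mul_le_of_le_one_right' (ENNReal.inv_le_one.2 ?_)
        exact_mod_cast hpos

theorem volume_ball_orthogonal (hd : 2 ≤ Module.finrank ℝ E) {e : E} (he : ‖e‖ = 1) (r : ℝ) :
    volume (ball (0 : (ℝ ∙ e)ᗮ) r) = ENNReal.ofReal r ^ (Module.finrank ℝ E - 1) *
      ENNReal.ofReal (√Real.pi ^ (Module.finrank ℝ E - 1) /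
        Real.Gamma (((Module.finrank ℝ E - 1 : ℕ) : ℝ) / 2 + 1)) := by
  have : Fact (Module.finrank ℝ E = (Module.finrank ℝ E - 1) + 1) := ⟨by omega⟩
  have hfr : Module.finrank ℝ (ℝ ∙ e)ᗮ = Module.finrank ℝ E - 1 :=
    Submodule.finrank_orthogonal_span_singleton (by rintro rfl; simp at he)
  have : Nontrivial (ℝ ∙ e)ᗮ := Module.nontrivial_of_finrank_pos (R := ℝ) (by omega)
  rw [InnerProductSpace.volume_ball, hfr]

theorem lintegral_poissonSymbol_one_mul {r : ℝ} (hr : 0 < r) :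
    ∫⁻ t : ℝ, ENNReal.ofReal (poissonSymbol 1 (t * r)) = ENNReal.ofReal r⁻¹ := by
  have hπ := Real.pi_pos
  have heq : ∀ t : ℝ, poissonSymbol 1 (t * r) = 2 * (1 + (2 * Real.pi * r * t) ^ 2)⁻¹ := by
    intro t; unfold poissonSymbol; rw [div_eq_mul_inv]; ring_nf
  simp_rw [heq]
  rw [← ofReal_integral_eq_lintegral_ofReal]
  · rw [integral_const_mul, Measure.integral_comp_mul_left (fun y => (1 + y ^ 2)⁻¹),
      integral_univ_inv_one_add_sq, smul_eq_mul, abs_of_pos (by positivity)]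
    congr 1; field_simp
  · exact (integrable_inv_one_add_sq.comp_mul_left' (by positivity)).const_mul 2
  · exact .of_forall fun t => by simp only [Pi.zero_apply]; positivity

/-- For bounded `ξ` the kernel is at most `2`. For large `ξ`, each line parallel to `ξ` contributes
at most `‖ξ‖⁻¹` to the ball integral, since the kernel has total mass one. -/
theorem exists_lintegral_toSphere_poissonSymbol_one_le (hd : 2 ≤ Module.finrank ℝ E) :
    ∃ C : ℝ≥0∞, C ≠ ⊤ ∧ ∀ ξ : E,
      ∫⁻ ζ : sphere (0 : E) 1, ENNReal.ofReal (poissonSymbol 1 (inner ℝ (ζ : E) ξ))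
        ∂(volume : Measure E).toSphere
      ≤ C * ENNReal.ofReal ((1 + (2 * Real.pi * ‖ξ‖) ^ 2) ^ (-(1 / 2) : ℝ)) := by
  have : Nontrivial E := Module.nontrivial_of_finrank_pos (R := ℝ) (by omega)
  have hπ := Real.pi_pos
  have hJ : ∀ T : ℝ, (1 + T ^ 2) ^ (-(1 / 2) : ℝ) = (√(1 + T ^ 2))⁻¹ := fun T => by
    rw [Real.rpow_neg (by positivity), Real.sqrt_eq_rpow]
  obtain ⟨V, hV, hVb⟩ : ∃ V : ℝ≥0∞, V ≠ ⊤ ∧ ∀ e : E, ‖e‖ = 1 → volume (ball (0 : (ℝ ∙ e)ᗮ) 1) = V :=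
    ⟨_, ENNReal.mul_ne_top (by simp) ENNReal.ofReal_ne_top, fun e he =>
      volume_ball_orthogonal hd he 1⟩
  set S := (volume : Measure E).toSphere Set.univ with hS
  have hStop : S ≠ ⊤ := measure_ne_top _ _
  refine ⟨4 * S + Module.finrank ℝ E * (V * ENNReal.ofReal (4 * Real.pi)),
    by finiteness, fun ξ => ?_⟩
  rw [hJ, add_mul]
  have hs0 : 0 < √(1 + (2 * Real.pi * ‖ξ‖) ^ 2) := Real.sqrt_pos.2 (by positivity)
  by_cases hξ : 2 * Real.pi * ‖ξ‖ ≤ 1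
  · refine le_trans ?_ le_self_add
    calc _ ≤ ∫⁻ ζ : sphere (0 : E) 1, 2 ∂(volume : Measure E).toSphere := by
          refine lintegral_mono fun ζ => ?_
          rw [← ENNReal.ofReal_ofNat]
          refine ENNReal.ofReal_le_ofReal ?_
          calc _ ≤ poissonSymbol 1 0 := poissonSymbol_anti one_pos (by simp)
            _ = _ := by norm_num [poissonSymbol]
      _ = 4 * S * ENNReal.ofReal (1 / 2) := by
          rw [lintegral_const, ← hS, mul_right_comm, ← ENNReal.ofReal_ofNat 4,
            ← ENNReal.ofReal_mul (by norm_num)]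
          norm_num
      _ ≤ _ := by
          gcongr
          rw [← one_div]
          refine one_div_le_one_div_of_le hs0 ?_
          rw [Real.sqrt_le_left (by norm_num)]
          have : 0 ≤ 2 * Real.pi * ‖ξ‖ := by positivity
          nlinarith
  · push Not at hξ
    refine le_trans ?_ le_add_self
    have hξ0 : 0 < ‖ξ‖ := by
      by_contra h
      have : ‖ξ‖ = 0 := le_antisymm (not_lt.1 h) (norm_nonneg _)
      rw [this] at hξ; norm_num at hξ
    refine (lintegral_toSphere_poissonSymbol_le one_pos ξ).trans ?_
    rw [mul_assoc]
    gcongr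
    obtain ⟨e, he, hξe⟩ := exists_unit_smul_eq ξ
    have hm := measurable_poissonSymbol 1
    have hm2 : Measurable fun x : E => ENNReal.ofReal (poissonSymbol 1 (inner ℝ x ξ)) := by
      fun_prop
    rw [← lintegral_indicator measurableSet_ball,
      ← lintegral_orthogonal_lintegral_line he (hm2.indicator measurableSet_ball)]
    calc _ ≤ ∫⁻ z : (ℝ ∙ e)ᗮ, (ball (0 : (ℝ ∙ e)ᗮ) 1).indicator
          (fun _ => ENNReal.ofReal ‖ξ‖⁻¹) z := by
          refine lintegral_mono fun z => ?_
          by_cases hz : z ∈ ball (0 : (ℝ ∙ e)ᗮ) 1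
          · rw [Set.indicator_of_mem hz, ← lintegral_poissonSymbol_one_mul hξ0]
            refine lintegral_mono fun t => (Set.indicator_le_self _ _ _).trans_eq ?_
            have := inner_orthogonal_add_smul he z t ‖ξ‖
            rw [← hξe] at this
            rw [this]
          · refine le_of_eq_of_le ?_ zero_le
            rw [lintegral_eq_zero_iff' ?_]
            · refine .of_forall fun t => Set.indicator_of_notMem ?_ _
              have := norm_orthogonal_add_smul_sq he z t
              rw [mem_ball_zero_iff, not_lt] at hz ⊢
              nlinarith [norm_nonneg ((z : E) + t • e), sq_nonneg t]
            · exact ((hm2.indicator measurableSet_ball).comp (by fun_prop)).aemeasurable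
      _ = ENNReal.ofReal ‖ξ‖⁻¹ * V := by
          rw [lintegral_indicator_const measurableSet_ball, hVb e he]
      _ ≤ _ := by
          rw [mul_comm, mul_assoc, ← ENNReal.ofReal_mul (by positivity)]
          gcongr
          rw [← div_eq_mul_inv, inv_eq_one_div, div_le_div_iff₀ hξ0 hs0, one_mul]
          refine (Real.sqrt_le_left (by positivity)).2 ?_
          nlinarith

/-- Near the hyperplane `ξ^⊥` there is a slab of thickness comparable to `δ / (1 + ‖ξ‖)` where the
kernel is at least `1/δ`. The product no longer depends on `δ`, which is what the limit `δ → 0`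
needs. -/
theorem exists_le_lintegral_toSphere_poissonSymbol (hd : 2 ≤ Module.finrank ℝ E) :
    ∃ c : ℝ≥0∞, c ≠ 0 ∧ ∀ δ : ℝ, 0 < δ → δ ≤ 1 → ∀ ξ : E,
      c * ENNReal.ofReal ((1 + (2 * Real.pi * ‖ξ‖) ^ 2) ^ (-(1 / 2) : ℝ)) ≤
      ∫⁻ ζ : sphere (0 : E) 1, ENNReal.ofReal (poissonSymbol δ (inner ℝ (ζ : E) ξ))
        ∂(volume : Measure E).toSphere := by
  have : Nontrivial E := Module.nontrivial_of_finrank_pos (R := ℝ) (by omega)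
  have hπ := Real.pi_pos
  have hJ : ∀ T : ℝ, (1 + T ^ 2) ^ (-(1 / 2) : ℝ) = (√(1 + T ^ 2))⁻¹ := fun T => by
    rw [Real.rpow_neg (by positivity), Real.sqrt_eq_rpow]
  obtain ⟨V, hV, hVb⟩ : ∃ V : ℝ≥0∞, V ≠ 0 ∧ ∀ e : E, ‖e‖ = 1 →
      volume (ball (0 : (ℝ ∙ e)ᗮ) (3 / 4) \ ball 0 (1 / 2)) = V := by
    refine ⟨_, ?_, fun e he => by
      rw [measure_sdiff (ball_subset_ball (by norm_num)) measurableSet_ball.nullMeasurableSet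
        measure_ball_lt_top.ne, volume_ball_orthogonal hd he, volume_ball_orthogonal hd he]⟩
    have hG : 0 < √Real.pi ^ (Module.finrank ℝ E - 1) /
        Real.Gamma (((Module.finrank ℝ E - 1 : ℕ) : ℝ) / 2 + 1) :=
      div_pos (by positivity) (Real.Gamma_pos_of_pos (by positivity))
    rw [← ENNReal.ofReal_pow (by norm_num), ← ENNReal.ofReal_pow (by norm_num),
      ← ENNReal.ofReal_mul (by positivity), ← ENNReal.ofReal_mul (by positivity)]
    refine (tsub_pos_of_lt ((ENNReal.ofReal_lt_ofReal_iff (by positivity)).2 ?_)).ne'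
    -- The annulus in `e^⊥` has positive volume because this hyperplane has positive dimension.
    have : Module.finrank ℝ E - 1 ≠ 0 := by omega
    exact mul_lt_mul_of_pos_right (pow_lt_pow_left₀ (by norm_num) (by norm_num) this) hG
  -- The `1/3` comes from `1 + 4π‖ξ‖ ≤ 3 √(1 + (2π‖ξ‖)²)`.
  refine ⟨V * ENNReal.ofReal (1 / 3), by simp [hV], fun δ hδ hδ1 ξ => ?_⟩
  refine le_trans ?_ (le_lintegral_toSphere_poissonSymbol hδ ξ)
  obtain ⟨e, he, hξe⟩ := exists_unit_smul_eq ξ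
  have hm := measurable_poissonSymbol δ
  have hm2 : Measurable fun x : E => ENNReal.ofReal (poissonSymbol δ (2 * inner ℝ x ξ)) := by
    fun_prop
  have hA : MeasurableSet (ball (0 : E) 1 \ ball 0 (1 / 2)) :=
    measurableSet_ball.diff measurableSet_ball
  have hB : MeasurableSet (ball (0 : (ℝ ∙ e)ᗮ) (3 / 4) \ ball 0 (1 / 2)) :=
    measurableSet_ball.diff measurableSet_ball
  rw [← lintegral_indicator hA, ← lintegral_orthogonal_lintegral_line he (hm2.indicator hA)]
  -- Half-thickness of the slab: `a ≤ 1/2` keeps it in the unit ball, as `(3/4)² + (1/2)² < 1`,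
  -- while `4π‖ξ‖a ≤ δ` forces the kernel to be at least `1/δ`.
  set a := δ / (2 * (1 + 4 * Real.pi * ‖ξ‖)) with ha
  have hξ0 : 0 ≤ Real.pi * ‖ξ‖ := by positivity
  have ha0 : 0 < a := by positivity
  have ha1 : a ≤ 1 / 2 := by
    rw [ha, div_le_div_iff₀ (by positivity) (by norm_num)]; nlinarith
  have ha2 : 4 * Real.pi * ‖ξ‖ * a ≤ δ := by
    rw [ha, mul_div_assoc', div_le_iff₀ (by positivity)]; nlinarith
  calc _ ≤ ∫⁻ z : (ℝ ∙ e)ᗮ, (ball (0 : (ℝ ∙ e)ᗮ) (3 / 4) \ ball 0 (1 / 2)).indicator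
        (fun _ => ENNReal.ofReal (1 / (1 + 4 * Real.pi * ‖ξ‖))) z := by
        rw [lintegral_indicator_const hB, hVb e he, mul_comm _ V, mul_assoc,
          ← ENNReal.ofReal_mul (by norm_num)]
        gcongr
        rw [hJ, ← one_div, div_mul_div_comm, one_mul]
        refine div_le_div_of_nonneg_left zero_le_one (by positivity) ?_
        have h1 : 1 ≤ √(1 + (2 * Real.pi * ‖ξ‖) ^ 2) := Real.one_le_sqrt.2 (by nlinarith)
        have h2 : 2 * Real.pi * ‖ξ‖ ≤ √(1 + (2 * Real.pi * ‖ξ‖) ^ 2) :=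
          Real.le_sqrt_of_sq_le (by linarith)
        linarith
    _ ≤ _ := by
        refine lintegral_mono fun z => ?_
        by_cases hz : z ∈ ball (0 : (ℝ ∙ e)ᗮ) (3 / 4) \ ball 0 (1 / 2)
        swap
        · rw [Set.indicator_of_notMem hz]; exact zero_le
        rw [Set.indicator_of_mem hz]
        simp only [Set.mem_sdiff, mem_ball_zero_iff, not_lt] at hz
        calc ENNReal.ofReal (1 / (1 + 4 * Real.pi * ‖ξ‖))
            = ∫⁻ t in Set.Icc (-a) a, ENNReal.ofReal (1 / δ) := by
              rw [setLIntegral_const, Real.volume_Icc, ← ENNReal.ofReal_mul (by positivity), ha]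
              congr 1; field_simp; ring
          _ ≤ _ := by
              refine (setLIntegral_mono_ae' measurableSet_Icc (.of_forall fun t ht => ?_)).trans
                (setLIntegral_le_lintegral _ _)
              have hN := norm_orthogonal_add_smul_sq he z t
              have hta : t ^ 2 ≤ a ^ 2 := sq_le_sq' ht.1 ht.2
              rw [Set.indicator_of_mem]
              · refine ENNReal.ofReal_le_ofReal ?_
                have := inner_orthogonal_add_smul he z t ‖ξ‖
                rw [← hξe] at this
                rw [this]
                unfold poissonSymbol
                rw [div_le_div_iff₀ hδ (by positivity)]
                have h3 : (2 * Real.pi * (2 * (t * ‖ξ‖))) ^ 2 ≤ δ ^ 2 := by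
                  calc _ = (4 * Real.pi * ‖ξ‖) ^ 2 * t ^ 2 := by ring
                    _ ≤ (4 * Real.pi * ‖ξ‖) ^ 2 * a ^ 2 := by gcongr
                    _ = (4 * Real.pi * ‖ξ‖ * a) ^ 2 := by ring
                    _ ≤ _ := by gcongr
                nlinarith
              · simp only [Set.mem_sdiff, mem_ball_zero_iff, not_lt]
                constructor
                · refine lt_of_pow_lt_pow_left₀ 2 zero_le_one ?_
                  nlinarith [norm_nonneg z]
                · refine le_of_sq_le_sq ?_ (norm_nonneg _)
                  nlinarith [norm_nonneg z, sq_nonneg t]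

end Sphere

/-! ### Damped ray integrals and Plancherel -/

section Ray

variable {E : Type*} [NormedAddCommGroup E] [InnerProductSpace ℝ E] [FiniteDimensional ℝ E]
  [MeasurableSpace E] [BorelSpace E]

/-- The Laplace transform at `δ` of the restriction of `f` to the ray from `x` in direction `e`. -/
noncomputable def rayLaplace (δ : ℝ) (e : E) (f : E → ℂ) (x : E) : ℂ :=
  ∫ s in Set.Ioi (0 : ℝ), (Real.exp (-(δ * s)) : ℂ) * f (x + s • e)

theorem integrableOn_exp_neg_mul {δ : ℝ} (hδ : 0 < δ) :
    IntegrableOn (fun s : ℝ => Real.exp (-(δ * s))) (Set.Ioi 0) := by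
  simpa using integrableOn_exp_mul_Ioi (neg_lt_zero.2 hδ) 0

theorem integrable_rayLaplace_integrand {δ : ℝ} (hδ : 0 < δ) (e : E) {f : E → ℂ}
    (hfm : Measurable f) (hf : Integrable f) :
    Integrable (fun p : E × ℝ => (Real.exp (-(δ * p.2)) : ℂ) * f (p.1 + p.2 • e))
      (volume.prod (volume.restrict (Set.Ioi 0))) := by
  have hmeas : Measurable fun p : E × ℝ => (Real.exp (-(δ * p.2)) : ℂ) * f (p.1 + p.2 • e) := by
    fun_prop
  rw [integrable_prod_iff' hmeas.aestronglyMeasurable]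
  constructor
  · exact .of_forall fun s => by exact (hf.comp_add_right (s • e)).const_mul (Real.exp (-(δ * s)) : ℂ)
  · have h : ∀ s : ℝ, ∫ x, ‖(Real.exp (-(δ * s)) : ℂ) * f (x + s • e)‖ =
        Real.exp (-(δ * s)) * ∫ x, ‖f x‖ := fun s => by
      simp_rw [norm_mul, Complex.norm_real, Real.norm_eq_abs, Real.abs_exp]
      rw [integral_const_mul, integral_add_right_eq_self (fun x => ‖f x‖)]
    simp_rw [h]
    exact (integrableOn_exp_neg_mul hδ).mul_const _

theorem integrable_rayLaplace {δ : ℝ} (hδ : 0 < δ) (e : E) {f : E → ℂ}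
    (hfm : Measurable f) (hf : Integrable f) : Integrable (rayLaplace δ e f) :=
  (integrable_rayLaplace_integrand hδ e hfm hf).integral_prod_left

/-- An average of translates of `f` against an integrable weight stays in `L²`, by Cauchy–Schwarz
and Tonelli. -/
theorem memLp_two_rayLaplace {δ : ℝ} (hδ : 0 < δ) (e : E) {f : E → ℂ}
    (hfm : Measurable f) (hf : Integrable f) (hf2 : MemLp f 2) :
    MemLp (rayLaplace δ e f) 2 := by
  refine ⟨(integrable_rayLaplace hδ e hfm hf).aestronglyMeasurable, ?_⟩
  have hlt : ∫⁻ x, ‖rayLaplace δ e f x‖ₑ ^ 2 < ⊤ := by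
    set K := ∫⁻ s in Set.Ioi (0 : ℝ), ENNReal.ofReal (Real.exp (-(δ * s))) with hK
    have hKtop : K ≠ ⊤ := by
      have := (integrableOn_exp_neg_mul hδ).lintegral_lt_top
      exact this.ne
    -- Half of the exponential weight goes to each factor in Cauchy–Schwarz.
    have hexp : ∀ s : ℝ, ENNReal.ofReal (Real.exp (-(δ * s / 2))) ^ 2 =
        ENNReal.ofReal (Real.exp (-(δ * s))) := fun s => by
      rw [← ENNReal.ofReal_pow (Real.exp_pos _).le, ← Real.exp_nat_mul]
      congr 2; push_cast; ring
    have hpt : ∀ x, ‖rayLaplace δ e f x‖ₑ ^ 2 ≤ K * ∫⁻ s in Set.Ioi (0 : ℝ),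
        ENNReal.ofReal (Real.exp (-(δ * s))) * ‖f (x + s • e)‖ₑ ^ 2 := fun x => by
      calc _ ≤ (∫⁻ s in Set.Ioi (0 : ℝ), ENNReal.ofReal (Real.exp (-(δ * s / 2))) *
            (ENNReal.ofReal (Real.exp (-(δ * s / 2))) * ‖f (x + s • e)‖ₑ)) ^ 2 := by
            gcongr
            refine (enorm_integral_le_lintegral_enorm _).trans_eq (lintegral_congr fun s => ?_)
            rw [← mul_assoc, ← sq, hexp, enorm_mul, ← ofReal_norm, Complex.norm_real,
              Real.norm_eq_abs, Real.abs_exp]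
        _ ≤ _ := (sq_lintegral_mul_le (by fun_prop) (by fun_prop)).trans_eq (by
            simp_rw [mul_pow, hexp]; rw [hK])
    calc _ ≤ ∫⁻ x, K * ∫⁻ s in Set.Ioi (0 : ℝ),
          ENNReal.ofReal (Real.exp (-(δ * s))) * ‖f (x + s • e)‖ₑ ^ 2 := lintegral_mono hpt
      _ = K * ∫⁻ s in Set.Ioi (0 : ℝ), ∫⁻ x,
          ENNReal.ofReal (Real.exp (-(δ * s))) * ‖f (x + s • e)‖ₑ ^ 2 := by
          rw [lintegral_const_mul' _ _ hKtop, lintegral_lintegral_swap]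
          fun_prop
      _ = K * (K * ∫⁻ x, ‖f x‖ₑ ^ 2) := by
          congr 1
          rw [hK, ← lintegral_mul_const _ (by fun_prop)]
          refine lintegral_congr fun s => ?_
          rw [lintegral_const_mul _ (by fun_prop),
            lintegral_add_right_eq_self (fun x => ‖f x‖ₑ ^ 2)]
      _ < ⊤ := by
          have : ∫⁻ x, ‖f x‖ₑ ^ 2 ≠ ⊤ := by
            rw [lintegral_enorm_sq]; exact ENNReal.pow_ne_top hf2.2.ne
          exact (ENNReal.mul_ne_top hKtop (ENNReal.mul_ne_top hKtop this)).lt_top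
  rw [lintegral_enorm_sq] at hlt
  by_contra h
  rw [not_lt, top_le_iff] at h
  simp [h] at hlt

theorem integral_exp_mul_fourierChar {δ : ℝ} (hδ : 0 < δ) (τ : ℝ) :
    ∫ s in Set.Ioi (0 : ℝ), (Real.exp (-(δ * s)) : ℂ) * (Real.fourierChar (s * τ) : ℂ) =
      (δ - 2 * Real.pi * τ * Complex.I)⁻¹ := by
  have h := integral_exp_mul_complex_Ioi (a := -(δ - 2 * Real.pi * τ * Complex.I))
    (by simp [hδ]) 0
  rw [Complex.ofReal_zero, mul_zero, Complex.exp_zero, neg_div_neg_eq, one_div] at h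
  rw [← h]
  refine integral_congr_ae (.of_forall fun s => ?_)
  simp only [Real.fourierChar_apply, Complex.ofReal_exp, ← Complex.exp_add]
  congr 1; push_cast; ring

/-- Translation by `s e` becomes a character in `s`, and the remaining `s`-integral is the Laplace
transform of that character. -/
theorem fourier_rayLaplace {δ : ℝ} (hδ : 0 < δ) (e : E) {f : E → ℂ}
    (hfm : Measurable f) (hf : Integrable f) (ξ : E) :
    𝓕 (rayLaplace δ e f) ξ =
      (δ - 2 * Real.pi * (inner ℝ e ξ : ℝ) * Complex.I)⁻¹ * 𝓕 f ξ := by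
  rw [← integral_exp_mul_fourierChar hδ, ← integral_mul_const]
  have hshift : ∀ s : ℝ, ∫ x, Real.fourierChar (-inner ℝ x ξ) • f (x + s • e) =
      Real.fourierChar (s * inner ℝ e ξ) • 𝓕 f ξ := fun s => by
    simp only [Real.fourier_eq, Circle.smul_def, smul_eq_mul]
    rw [← integral_const_mul, ← integral_add_right_eq_self (fun x =>
      (Real.fourierChar (s * inner ℝ e ξ) : ℂ) * (Real.fourierChar (-inner ℝ x ξ) * f x)) (s • e)]
    refine integral_congr_ae (.of_forall fun x => ?_)
    simp only [← mul_assoc, ← Circle.coe_mul, ← AddChar.map_add_eq_mul]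
    congr 3
    rw [inner_add_left, real_inner_smul_left]; ring
  calc 𝓕 (rayLaplace δ e f) ξ
      = ∫ x, ∫ s in Set.Ioi (0 : ℝ), Real.fourierChar (-inner ℝ x ξ) •
          ((Real.exp (-(δ * s)) : ℂ) * f (x + s • e)) := by
        rw [Real.fourier_eq]
        simp only [Circle.smul_def, smul_eq_mul, integral_const_mul]; rfl
    _ = ∫ s in Set.Ioi (0 : ℝ), ∫ x, Real.fourierChar (-inner ℝ x ξ) •
          ((Real.exp (-(δ * s)) : ℂ) * f (x + s • e)) := by
        refine integral_integral_swap ?_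
        refine (integrable_rayLaplace_integrand hδ e hfm hf).norm.mono' ?_ (.of_forall fun p => ?_)
        · have : Measurable fun p : E × ℝ => Real.fourierChar (-inner ℝ p.1 ξ) •
              ((Real.exp (-(δ * p.2)) : ℂ) * f (p.1 + p.2 • e)) := by
            simp_rw [Circle.smul_def, Real.fourierChar_apply]
            fun_prop
          exact this.aestronglyMeasurable
        · simp [Function.uncurry]
    _ = _ := by
        refine integral_congr_ae (.of_forall fun s => ?_)
        have h := hshift s
        simp only [Circle.smul_def, smul_eq_mul, mul_left_comm (_ : ℂ) (Real.exp _ : ℂ)] at h ⊢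
        rw [integral_const_mul, h, mul_assoc]

theorem lintegral_enorm_sq_rayLaplace {δ : ℝ} (hδ : 0 < δ) (e : E) {f : E → ℂ}
    (hfm : Measurable f) (hf : Integrable f) (hf2 : MemLp f 2) :
    ENNReal.ofReal (2 * δ) * ∫⁻ x, ‖rayLaplace δ e f x‖ₑ ^ 2 =
      ∫⁻ ξ, ‖𝓕 f ξ‖ₑ ^ 2 * ENNReal.ofReal (poissonSymbol δ (inner ℝ e ξ)) := by
  rw [← lintegral_enorm_sq_fourier (integrable_rayLaplace hδ e hfm hf)
    (memLp_two_rayLaplace hδ e hfm hf hf2), ← lintegral_const_mul' _ _ ENNReal.ofReal_ne_top]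
  refine lintegral_congr fun ξ => ?_
  have hn : ‖((δ : ℂ) - 2 * Real.pi * (inner ℝ e ξ : ℝ) * Complex.I)⁻¹‖ ^ 2 =
      (δ ^ 2 + (2 * Real.pi * inner ℝ e ξ) ^ 2)⁻¹ := by
    rw [norm_inv, inv_pow, ← Complex.normSq_eq_norm_sq, Complex.normSq_apply]
    simp; ring
  rw [fourier_rayLaplace hδ e hfm hf, enorm_mul, mul_pow, ← mul_assoc, mul_comm]
  congr 1
  rw [← ofReal_norm, ← ENNReal.ofReal_pow (norm_nonneg _), hn,
    ← ENNReal.ofReal_mul (by positivity), poissonSymbol, div_eq_mul_inv]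

end Ray

/-! ### One-dimensional estimates on a single line -/

section Line

/-- The Laplace transform at `δ` of `h (r + ·)`. -/
noncomputable def lineLaplace (δ : ℝ) (h : ℝ → ℂ) (r : ℝ) : ℂ :=
  ∫ s in Set.Ioi (0 : ℝ), (Real.exp (-(δ * s)) : ℂ) * h (r + s)

theorem measurable_lineLaplace (δ : ℝ) {h : ℝ → ℂ} (hm : Measurable h) :
    Measurable (lineLaplace δ h) := by
  have : Measurable fun p : ℝ × ℝ => (Real.exp (-(δ * p.2)) : ℂ) * h (p.1 + p.2) := by fun_prop
  exact (this.stronglyMeasurable.integral_prod_right (ν := volume.restrict (Set.Ioi 0))).measurable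

theorem lineLaplace_eq (δ : ℝ) (h : ℝ → ℂ) (r : ℝ) :
    lineLaplace δ h r = ∫ t in Set.Ioi r, (Real.exp (-(δ * (t - r))) : ℂ) * h t := by
  rw [lineLaplace, ← integral_indicator measurableSet_Ioi, ← integral_indicator measurableSet_Ioi]
  refine Eq.trans ?_ (integral_add_left_eq_self _ r)
  refine integral_congr_ae (.of_forall fun s => ?_)
  simp only [Set.indicator, Set.mem_Ioi, lt_add_iff_pos_right, add_sub_cancel_left]

theorem enorm_exp_neg_mul_le {δ s : ℝ} (hδ : 0 ≤ δ) (hs : 0 ≤ s) (c : ℂ) :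
    ‖(Real.exp (-(δ * s)) : ℂ) * c‖ₑ ≤ ‖c‖ₑ := by
  rw [enorm_le_iff_norm_le, norm_mul, Complex.norm_real, Real.norm_eq_abs, Real.abs_exp]
  exact mul_le_of_le_one_left (norm_nonneg _) (Real.exp_le_one_iff.2 (by nlinarith))

theorem enorm_lineLaplace_le {δ : ℝ} (hδ : 0 ≤ δ) (h : ℝ → ℂ) (r : ℝ) :
    ‖lineLaplace δ h r‖ₑ ≤ ∫⁻ t, ‖h t‖ₑ := by
  rw [lineLaplace_eq]
  refine (enorm_integral_le_lintegral_enorm _).trans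
    ((setLIntegral_mono_ae' measurableSet_Ioi (.of_forall fun t ht => ?_)).trans
      (setLIntegral_le_lintegral _ _))
  exact enorm_exp_neg_mul_le hδ (sub_nonneg.2 (le_of_lt ht)) _

variable {R : ℝ} {h : ℝ → ℂ}

theorem lineLaplace_eq_zero (hs : ∀ t, R ≤ |t| → h t = 0) (δ : ℝ) {r : ℝ} (hr : R ≤ r) :
    lineLaplace δ h r = 0 := by
  rw [lineLaplace_eq]
  refine setIntegral_eq_zero_of_forall_eq_zero fun t ht => ?_
  rw [hs t (hr.trans ((le_of_lt ht).trans (le_abs_self t))), mul_zero]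

theorem lineLaplace_of_le (hs : ∀ t, R ≤ |t| → h t = 0) (δ : ℝ) {r : ℝ} (hr : r ≤ -R) :
    lineLaplace δ h r =
      Real.exp (δ * (r + R)) * ∫ t, (Real.exp (-(δ * (t + R))) : ℂ) * h t := by
  rw [lineLaplace_eq, ← integral_const_mul, setIntegral_eq_integral_of_forall_compl_eq_zero]
  · refine integral_congr_ae (.of_forall fun t => ?_)
    simp only [← mul_assoc, ← Complex.ofReal_mul, ← Real.exp_add]
    ring_nf
  · intro t ht
    have ht' : t ≤ r := not_lt.1 ht
    rw [hs t (by rw [le_abs]; right; linarith), mul_zero]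

theorem lintegral_Iic_exp {δ : ℝ} (hδ : 0 < δ) (R : ℝ) :
    ∫⁻ r in Set.Iic (-R), ENNReal.ofReal (Real.exp (δ * (r + R))) ^ 2 =
      ENNReal.ofReal (2 * δ)⁻¹ := by
  have h1 : ∀ r, ENNReal.ofReal (Real.exp (δ * (r + R))) ^ 2 =
      ENNReal.ofReal (Real.exp (2 * δ * R) * Real.exp (2 * δ * r)) := fun r => by
    rw [← ENNReal.ofReal_pow (Real.exp_pos _).le, ← Real.exp_nat_mul, ← Real.exp_add]
    congr 2; push_cast; ring
  simp_rw [h1]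
  rw [← ofReal_integral_eq_lintegral_ofReal]
  · rw [integral_const_mul, integral_exp_mul_Iic (by positivity), ← mul_div_assoc, ← Real.exp_add]
    congr 1; rw [← one_div]; congr 1
    rw [Real.exp_eq_one_iff]; ring
  · exact (integrableOn_exp_mul_Iic (by positivity) _).const_mul _
  · exact .of_forall fun r => by positivity

/-- On the support, `0 ≤ t + R ≤ 2R`, so the damping factor differs from one by at most `2Rδ`. -/
theorem enorm_integral_exp_le (hR : 0 ≤ R) (hi : Integrable h) (hs : ∀ t, R ≤ |t| → h t = 0)
    {δ : ℝ} (hδ : 0 ≤ δ) :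
    ‖∫ t, (Real.exp (-(δ * (t + R))) : ℂ) * h t‖ₑ ≤
      ‖∫ t, h t‖ₑ + ENNReal.ofReal (2 * R * δ) * ∫⁻ t, ‖h t‖ₑ := by
  have hexp : ∀ t, ‖((Real.exp (-(δ * (t + R))) : ℂ) - 1) * h t‖ₑ ≤
      ENNReal.ofReal (2 * R * δ) * ‖h t‖ₑ := fun t => by
    by_cases ht : R ≤ |t|
    · simp [hs t ht]
    · rw [not_le, abs_lt] at ht
      rw [enorm_mul]
      gcongr
      rw [← Complex.ofReal_one, ← Complex.ofReal_sub, ← ofReal_norm, Complex.norm_real,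
        Real.norm_eq_abs, abs_sub_comm]
      refine ENNReal.ofReal_le_ofReal ?_
      have h1 := Real.add_one_le_exp (-(δ * (t + R)))
      have h2 : Real.exp (-(δ * (t + R))) ≤ 1 := Real.exp_le_one_iff.2 (by nlinarith)
      rw [abs_of_nonneg (by linarith)]
      nlinarith
  have hi2 : Integrable fun t => ((Real.exp (-(δ * (t + R))) : ℂ) - 1) * h t := by
    refine (hi.norm.const_mul (2 * R * δ)).mono' ?_ (.of_forall fun t => ?_)
    · exact (Continuous.aestronglyMeasurable (by fun_prop)).mul hi.aestronglyMeasurable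
    · have := hexp t
      rw [← ofReal_norm, ← ofReal_norm, ← ENNReal.ofReal_mul (by positivity)] at this
      exact (ENNReal.ofReal_le_ofReal_iff (by positivity)).1 this
  have heq : ∀ t, (Real.exp (-(δ * (t + R))) : ℂ) * h t =
      h t + ((Real.exp (-(δ * (t + R))) : ℂ) - 1) * h t := fun t => by ring
  simp_rw [heq]
  rw [integral_add hi hi2]
  refine (enorm_add_le _ _).trans ?_
  gcongr
  rw [← lintegral_const_mul' _ _ ENNReal.ofReal_ne_top]
  exact (enorm_integral_le_lintegral_enorm _).trans (lintegral_mono hexp)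

theorem lintegral_Iic_enorm_sq_lineLaplace (hs : ∀ t, R ≤ |t| → h t = 0) {δ : ℝ} (hδ : 0 < δ) :
    ∫⁻ r in Set.Iic (-R), ‖lineLaplace δ h r‖ₑ ^ 2 =
      ENNReal.ofReal (2 * δ)⁻¹ * ‖∫ t, (Real.exp (-(δ * (t + R))) : ℂ) * h t‖ₑ ^ 2 := by
  rw [← lintegral_Iic_exp hδ R, ← lintegral_mul_const _ (by fun_prop)]
  refine setLIntegral_congr_fun measurableSet_Iic fun r hr => ?_
  rw [lineLaplace_of_le hs δ hr, enorm_mul, mul_pow, ← ofReal_norm (_ : ℂ), Complex.norm_real,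
    Real.norm_eq_abs, Real.abs_exp]

/-- Left of `-R` the transform is an explicit exponential, whose energy times `2δ` is the squared
damped integral. The window of length `2R` costs `O(δ)`, and right of `R` nothing is left. -/
theorem lintegral_enorm_sq_lineLaplace_le (hR : 0 ≤ R) (hi : Integrable h)
    (hs : ∀ t, R ≤ |t| → h t = 0) {δ : ℝ} (hδ : 0 < δ) :
    ENNReal.ofReal (2 * δ) * ∫⁻ r, ‖lineLaplace δ h r‖ₑ ^ 2 ≤
      (‖∫ t, h t‖ₑ + ENNReal.ofReal (2 * R * δ) * ∫⁻ t, ‖h t‖ₑ) ^ 2 +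
        ENNReal.ofReal (4 * R * δ) * (∫⁻ t, ‖h t‖ₑ) ^ 2 := by
  have hsplit : ∫⁻ r, ‖lineLaplace δ h r‖ₑ ^ 2 ≤
      (∫⁻ r in Set.Iic (-R), ‖lineLaplace δ h r‖ₑ ^ 2) +
        ∫⁻ r in Set.Ioc (-R) R, (∫⁻ t, ‖h t‖ₑ) ^ 2 := by
    rw [← lintegral_add_compl _ (measurableSet_Iic (a := -R))]
    gcongr ?_ + ?_
    · exact le_rfl
    rw [Set.compl_Iic, ← lintegral_indicator measurableSet_Ioi,
      ← lintegral_indicator measurableSet_Ioc]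
    refine lintegral_mono fun r => ?_
    by_cases hr : r ∈ Set.Ioc (-R) R
    · rw [Set.indicator_of_mem hr, Set.indicator_of_mem (show r ∈ Set.Ioi (-R) from hr.1)]
      exact pow_le_pow_left' (enorm_lineLaplace_le hδ.le h r) 2
    · refine le_of_eq_of_le ?_ zero_le
      rw [Set.indicator_apply_eq_zero]
      intro hr1
      have hr2 : R < r := lt_of_not_ge fun h2 => hr ⟨hr1, h2⟩
      simp [lineLaplace_eq_zero hs δ hr2.le]
  refine (mul_le_mul_right hsplit _).trans ?_
  rw [mul_add, lintegral_Iic_enorm_sq_lineLaplace hs hδ, ← mul_assoc,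
    ← ENNReal.ofReal_mul (by positivity), mul_inv_cancel₀ (by positivity), ENNReal.ofReal_one,
    one_mul]
  gcongr ?_ ^ 2 + ?_
  · exact enorm_integral_exp_le hR hi hs hδ.le
  · rw [setLIntegral_const, Real.volume_Ioc, mul_left_comm, ← ENNReal.ofReal_mul (by positivity),
      mul_comm]
    exact mul_le_mul_left (ENNReal.ofReal_le_ofReal (by linarith)) _

/-- This is integration by parts for `h = u - u'`, where `u` is the transform at `δ = 1`: `u`
vanishes at `R`, and the boundary term is `v(-R) u(-R)`. As `h` is merely integrable, the proof uses
Fubini and the derivative of `exp(r) v(r)` instead of differentiating `u`. -/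
theorem integral_mul_eq_lineLaplace (hm : Measurable h) (hi : Integrable h)
    (hs : ∀ t, R ≤ |t| → h t = 0) {v v' : ℝ → ℂ} (hv : ∀ t, HasDerivAt v (v' t) t)
    (hv' : Continuous v') :
    ∫ t, h t * v t = v (-R) * (∫ t, (Real.exp (-(1 * (t + R))) : ℂ) * h t) +
      ∫ r in Set.Ioc (-R) R, (v r + v' r) * lineLaplace 1 h r := by
  have hvc : Continuous v := continuous_iff_continuousAt.2 fun t => (hv t).continuousAt
  set F : ℝ × ℝ → ℂ := {p : ℝ × ℝ | p.2 < p.1}.indicator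
    (fun p => (v p.2 + v' p.2) * ((Real.exp (-(1 * (p.1 - p.2))) : ℂ) * h p.1)) with hF
  have hFm : Measurable F := Measurable.indicator (by fun_prop)
    (measurableSet_lt measurable_snd measurable_fst)
  obtain ⟨M, hM⟩ := (isCompact_Icc (a := -R) (b := R)).exists_bound_of_continuousOn
    (hvc.add hv').continuousOn
  have hFi : Integrable F (volume.prod (volume.restrict (Set.Ioc (-R) R))) := by
    have h1 : Integrable (fun p : ℝ × ℝ => ‖h p.1‖ * M)
        (volume.prod (volume.restrict (Set.Ioc (-R) R))) :=
      hi.norm.mul_prod (integrable_const M)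
    refine h1.mono' hFm.aestronglyMeasurable ?_
    have h2 : ∀ᵐ p ∂((volume : Measure ℝ).prod (volume.restrict (Set.Ioc (-R) R))),
        p.2 ∈ Set.Ioc (-R) R :=
      Measure.quasiMeasurePreserving_snd.ae (ae_restrict_mem measurableSet_Ioc)
    filter_upwards [h2] with p hp
    have hMp : ‖v p.2 + v' p.2‖ ≤ M := hM p.2 ⟨hp.1.le, hp.2⟩
    have hM0 : 0 ≤ M := (norm_nonneg _).trans hMp
    by_cases hlt : p.2 < p.1
    · rw [hF, Set.indicator_of_mem (by exact hlt), norm_mul, mul_comm]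
      gcongr
      rw [norm_mul, Complex.norm_real, Real.norm_eq_abs, Real.abs_exp]
      exact mul_le_of_le_one_left (norm_nonneg _) (Real.exp_le_one_iff.2 (by linarith))
    · rw [hF, Set.indicator_of_notMem (by exact hlt), norm_zero]; positivity
  have hpt : ∀ t, h t * v t = v (-R) * ((Real.exp (-(1 * (t + R))) : ℂ) * h t) +
      ∫ r in Set.Ioc (-R) R, F (t, r) := by
    intro t
    by_cases ht : R ≤ |t|
    · have : ∀ r, F (t, r) = 0 := fun r => by
        rw [hF]; simp [Set.indicator, hs t ht]
      simp [this, hs t ht]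
    rw [not_le, abs_lt] at ht
    have hd : ∀ r, HasDerivAt (fun r : ℝ => (Real.exp r : ℂ) * v r)
        ((Real.exp r : ℂ) * (v r + v' r)) r := fun r => by
      convert! ((Real.hasDerivAt_exp r).ofReal_comp).mul (hv r) using 1
      ring
    have hftc := intervalIntegral.integral_eq_sub_of_hasDerivAt (a := -R) (b := t)
      (fun r _ => hd r) (Continuous.intervalIntegrable (by fun_prop) _ _)
    rw [intervalIntegral.integral_of_le ht.1.le] at hftc
    have hI : ∫ r in Set.Ioc (-R) R, F (t, r) = ((Real.exp (-t) : ℂ) * h t) *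
        ∫ r in Set.Ioc (-R) t, (Real.exp r : ℂ) * (v r + v' r) := by
      -- `F` lives on the strict inequality `r < t`, so the endpoint `r = t` is dropped.
      rw [← integral_const_mul, integral_Ioc_eq_integral_Ioo (y := t),
        ← integral_indicator measurableSet_Ioc, ← integral_indicator measurableSet_Ioo]
      refine integral_congr_ae (.of_forall fun r => ?_)
      by_cases hr : r ∈ Set.Ioo (-R) t
      · rw [Set.indicator_of_mem (show r ∈ Set.Ioc (-R) R from ⟨hr.1, (hr.2.trans ht.2).le⟩),
          Set.indicator_of_mem hr, hF, Set.indicator_of_mem (by exact hr.2)]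
        have : Real.exp (-(1 * (t - r))) = Real.exp (-t) * Real.exp r := by
          rw [← Real.exp_add]; ring_nf
        rw [this]; push_cast; ring
      · rw [Set.indicator_of_notMem hr]
        by_cases hr2 : r ∈ Set.Ioc (-R) R
        · rw [Set.indicator_of_mem hr2, hF, Set.indicator_of_notMem]
          exact fun h3 => hr ⟨hr2.1, h3⟩
        · rw [Set.indicator_of_notMem hr2]
    rw [hI, hftc]
    have h1 : Real.exp (-(1 * (t + R))) = Real.exp (-t) * Real.exp (-R) := by
      rw [← Real.exp_add]; ring_nf
    have h2 : (Real.exp (-t) : ℂ) * Real.exp t = 1 := by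
      rw [← Complex.ofReal_mul, ← Real.exp_add]; simp
    rw [h1]; push_cast at h2 ⊢
    linear_combination -(h t * v t) * h2
  have hi1 : Integrable fun t => v (-R) * ((Real.exp (-(1 * (t + R))) : ℂ) * h t) := by
    refine (hi.norm.mono' (Measurable.aestronglyMeasurable (by fun_prop))
      (.of_forall fun t => ?_)).const_mul _
    by_cases ht : R ≤ |t|
    · simp [hs t ht]
    rw [not_le, abs_lt] at ht
    rw [norm_mul, Complex.norm_real, Real.norm_eq_abs, Real.abs_exp]
    exact mul_le_of_le_one_left (norm_nonneg _) (Real.exp_le_one_iff.2 (by linarith))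
  simp_rw [hpt]
  rw [integral_add hi1 hFi.integral_prod_left, integral_const_mul, integral_integral_swap (f := fun t r => F (t, r)) hFi]
  congr 1
  refine integral_congr_ae (.of_forall fun r => ?_)
  simp only
  rw [lineLaplace_eq, ← integral_const_mul, ← integral_indicator measurableSet_Ioi]
  rfl

/-- The boundary value at `-R` is controlled by the energy of the exponential tail to its left, and
the remaining integral by Cauchy–Schwarz on the window. These give the `4` and the `16R`
respectively. -/
theorem enorm_sq_integral_mul_le (hR : 0 ≤ R) (hm : Measurable h) (hi : Integrable h)
    (hs : ∀ t, R ≤ |t| → h t = 0) {v v' : ℝ → ℂ} (hv : ∀ t, HasDerivAt v (v' t) t)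
    (hv' : Continuous v') {ε : ℝ} (hε : 0 ≤ ε) (hvε : ∀ t, |t| ≤ R → ‖v t‖ ≤ ε)
    (hvε' : ∀ t, |t| ≤ R → ‖v' t‖ ≤ ε) :
    ‖∫ t, h t * v t‖ₑ ^ 2 ≤
      ENNReal.ofReal ((4 + 16 * R) * ε ^ 2) * ∫⁻ r, ‖lineLaplace 1 h r‖ₑ ^ 2 := by
  set I := ∫⁻ r, ‖lineLaplace 1 h r‖ₑ ^ 2 with hI
  set c := ∫ t, (Real.exp (-(1 * (t + R))) : ℂ) * h t with hc
  have hcI : ‖c‖ₑ ^ 2 ≤ 2 * I := by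
    have h1 := lintegral_Iic_enorm_sq_lineLaplace hs one_pos
    have h2 : ENNReal.ofReal (2 * 1)⁻¹ * ‖c‖ₑ ^ 2 ≤ I := by
      rw [← h1]; exact setLIntegral_le_lintegral _ _
    calc ‖c‖ₑ ^ 2 = 2 * (ENNReal.ofReal (2 * 1)⁻¹ * ‖c‖ₑ ^ 2) := by
          rw [← mul_assoc, ← ENNReal.ofReal_ofNat 2, ← ENNReal.ofReal_mul (by norm_num)]; norm_num
      _ ≤ _ := by gcongr
  have hG := measurable_lineLaplace 1 hm
  have hcs : (∫⁻ r in Set.Ioc (-R) R, ENNReal.ofReal (2 * ε) * ‖lineLaplace 1 h r‖ₑ) ^ 2 ≤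
      ENNReal.ofReal (8 * R * ε ^ 2) * I := by
    refine (sq_lintegral_mul_le (by fun_prop) (by fun_prop)).trans ?_
    gcongr ?_ * ?_
    · rw [setLIntegral_const, Real.volume_Ioc, ← ENNReal.ofReal_pow (by positivity),
        ← ENNReal.ofReal_mul (by positivity)]
      refine ENNReal.ofReal_le_ofReal (by nlinarith)
    · exact setLIntegral_le_lintegral _ _
  rw [integral_mul_eq_lineLaplace hm hi hs hv hv', ← hc]
  calc _ ≤ (ENNReal.ofReal ε * ‖c‖ₑ +
        ∫⁻ r in Set.Ioc (-R) R, ENNReal.ofReal (2 * ε) * ‖lineLaplace 1 h r‖ₑ) ^ 2 := by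
        gcongr
        refine (enorm_add_le _ _).trans ?_
        gcongr ?_ + ?_
        · rw [enorm_mul]
          gcongr
          rw [← ofReal_norm]
          exact ENNReal.ofReal_le_ofReal (hvε _ (by rw [abs_neg, abs_of_nonneg hR]))
        · refine (enorm_integral_le_lintegral_enorm _).trans
            (setLIntegral_mono_ae' measurableSet_Ioc (.of_forall fun r hr => ?_))
          rw [enorm_mul]
          gcongr
          rw [← ofReal_norm]
          have hr' : |r| ≤ R := abs_le.2 ⟨hr.1.le, hr.2⟩
          refine ENNReal.ofReal_le_ofReal ((norm_add_le _ _).trans ?_)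
          linarith [hvε r hr', hvε' r hr']
    _ ≤ 2 * (ENNReal.ofReal ε * ‖c‖ₑ) ^ 2 +
        2 * (∫⁻ r in Set.Ioc (-R) R, ENNReal.ofReal (2 * ε) * ‖lineLaplace 1 h r‖ₑ) ^ 2 :=
        add_sq_le_two_mul _ _
    _ ≤ 2 * (ENNReal.ofReal (ε ^ 2) * (2 * I)) + 2 * (ENNReal.ofReal (8 * R * ε ^ 2) * I) := by
        rw [mul_pow, ← ENNReal.ofReal_pow hε]
        gcongr
    _ = _ := by
        have h1 : ENNReal.ofReal (2 * (ε ^ 2 * 2)) = 2 * (ENNReal.ofReal (ε ^ 2) * 2) := by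
          rw [ENNReal.ofReal_mul (by norm_num), ENNReal.ofReal_mul (by positivity)]
          simp only [ENNReal.ofReal_ofNat]
        have h2 : ENNReal.ofReal (2 * (8 * R * ε ^ 2)) = 2 * ENNReal.ofReal (8 * R * ε ^ 2) := by
          rw [ENNReal.ofReal_mul (by norm_num), ENNReal.ofReal_ofNat]
        rw [show (4 + 16 * R) * ε ^ 2 = 2 * (ε ^ 2 * 2) + 2 * (8 * R * ε ^ 2) by ring,
          ENNReal.ofReal_add (by positivity) (by positivity), h1, h2]
        ring

end Line

/-! ### Integration over all lines in one direction -/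

section LineFamily

variable {E : Type*} [NormedAddCommGroup E] [InnerProductSpace ℝ E] [FiniteDimensional ℝ E]
  [MeasurableSpace E] [BorelSpace E] {R : ℝ} {f : E → ℂ} {e : E}

theorem MeasureTheory.MemLp.integrable_of_eq_zero_of_le_norm {f : E → ℂ} (hf2 : MemLp f 2)
    (hfs : ∀ x, R ≤ ‖x‖ → f x = 0) : Integrable f := by
  rw [← integrableOn_iff_integrable_of_support_subset (s := ball 0 R)]
  · have : IsFiniteMeasure (volume.restrict (ball (0 : E) R)) :=
      ⟨by simpa using measure_ball_lt_top⟩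
    exact (hf2.restrict _).integrable (by norm_num)
  · intro x hx
    by_contra h
    exact hx (hfs x (by simpa using h))

omit [FiniteDimensional ℝ E] [MeasurableSpace E] [BorelSpace E] in
theorem eq_zero_of_le_abs (he : ‖e‖ = 1) (hfs : ∀ x, R ≤ ‖x‖ → f x = 0)
    (z : (ℝ ∙ e)ᗮ) (t : ℝ) (ht : R ≤ |t|) : f ((z : E) + t • e) = 0 := by
  refine hfs _ (ht.trans (abs_le_of_sq_le_sq ?_ (norm_nonneg _)))
  rw [norm_orthogonal_add_smul_sq he]
  nlinarith [norm_nonneg z]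

omit [FiniteDimensional ℝ E] [MeasurableSpace E] [BorelSpace E] in
theorem eq_zero_of_le_norm (he : ‖e‖ = 1) (hfs : ∀ x, R ≤ ‖x‖ → f x = 0)
    (z : (ℝ ∙ e)ᗮ) (hz : R ≤ ‖z‖) (t : ℝ) : f ((z : E) + t • e) = 0 := by
  refine hfs _ (hz.trans ((le_abs_self _).trans (abs_le_of_sq_le_sq ?_ (norm_nonneg _))))
  rw [norm_orthogonal_add_smul_sq he]
  nlinarith [norm_nonneg z]

theorem ae_integrable_line (he : ‖e‖ = 1) (hf : Integrable f) :
    ∀ᵐ z : (ℝ ∙ e)ᗮ, Integrable fun t : ℝ => f ((z : E) + t • e) :=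
  ((measurePreserving_orthogonal_add_smul he).integrable_comp_of_integrable hf).prod_right_ae

theorem sq_lintegral_enorm_le {h : ℝ → ℂ} (hm : Measurable h) (hs : ∀ t, R ≤ |t| → h t = 0) :
    (∫⁻ t, ‖h t‖ₑ) ^ 2 ≤ ENNReal.ofReal (2 * R) * ∫⁻ t, ‖h t‖ₑ ^ 2 := by
  have h1 : ∫⁻ t, ‖h t‖ₑ = ∫⁻ t in Set.Icc (-R) R, 1 * ‖h t‖ₑ := by
    rw [← lintegral_indicator measurableSet_Icc]
    refine lintegral_congr fun t => ?_
    by_cases ht : t ∈ Set.Icc (-R) R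
    · simp [ht]
    · rw [Set.indicator_of_notMem ht, hs t, enorm_zero]
      by_contra h2
      exact ht (abs_le.1 (not_le.1 h2).le)
  rw [h1]
  refine (sq_lintegral_mul_le (by fun_prop) (by fun_prop)).trans ?_
  gcongr ?_ * ?_
  · rw [one_pow, setLIntegral_const, Real.volume_Icc, one_mul]
    exact ENNReal.ofReal_le_ofReal (by linarith)
  · exact setLIntegral_le_lintegral _ _

theorem lintegral_sq_lintegral_line_le (he : ‖e‖ = 1) (hfm : Measurable f)
    (hfs : ∀ x, R ≤ ‖x‖ → f x = 0) :
    ∫⁻ z : (ℝ ∙ e)ᗮ, (∫⁻ t : ℝ, ‖f ((z : E) + t • e)‖ₑ) ^ 2 ≤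
      ENNReal.ofReal (2 * R) * ∫⁻ x, ‖f x‖ₑ ^ 2 := by
  rw [← lintegral_orthogonal_lintegral_line he (hfm.enorm.pow_const 2),
    ← lintegral_const_mul' _ _ ENNReal.ofReal_ne_top]
  exact lintegral_mono fun z => sq_lintegral_enorm_le (by fun_prop) (eq_zero_of_le_abs he hfs z)

theorem lintegral_lineLaplace (δ : ℝ) (he : ‖e‖ = 1) (hfm : Measurable f) :
    ∫⁻ z : (ℝ ∙ e)ᗮ, ∫⁻ r, ‖lineLaplace δ (fun t => f ((z : E) + t • e)) r‖ₑ ^ 2 =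
      ∫⁻ x, ‖rayLaplace δ e f x‖ₑ ^ 2 := by
  have hm : Measurable (rayLaplace δ e f) := by
    have : Measurable fun p : E × ℝ => (Real.exp (-(δ * p.2)) : ℂ) * f (p.1 + p.2 • e) := by
      fun_prop
    exact (this.stronglyMeasurable.integral_prod_right
      (ν := volume.restrict (Set.Ioi 0))).measurable
  rw [← lintegral_orthogonal_lintegral_line he (hm.enorm.pow_const 2)]
  simp only [lineLaplace, rayLaplace, add_smul, add_assoc]

/-- The single-line energy bound is integrated over `e^⊥`. Bounding the cross term by `|∫ h| ≤ ∫
|h|` leaves the main term with coefficient exactly one and an error linear in `δ`. -/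
theorem lintegral_poissonSymbol_le (hR : 0 ≤ R) (he : ‖e‖ = 1) (hfm : Measurable f)
    (hf2 : MemLp f 2) (hfs : ∀ x, R ≤ ‖x‖ → f x = 0) {δ : ℝ} (hδ : 0 < δ) (hδ1 : δ ≤ 1) :
    ∫⁻ ξ, ‖𝓕 f ξ‖ₑ ^ 2 * ENNReal.ofReal (poissonSymbol δ (inner ℝ e ξ)) ≤
      (∫⁻ z : (ℝ ∙ e)ᗮ, ‖∫ t : ℝ, f ((z : E) + t • e)‖ₑ ^ 2) +
        ENNReal.ofReal δ * (ENNReal.ofReal ((8 * R + 4 * R ^ 2) * (2 * R)) * ∫⁻ x, ‖f x‖ₑ ^ 2) := by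
  have hf := hf2.integrable_of_eq_zero_of_le_norm hfs
  rw [← lintegral_enorm_sq_rayLaplace hδ e hfm hf hf2, ← lintegral_lineLaplace δ he hfm,
    ← lintegral_const_mul' _ _ ENNReal.ofReal_ne_top]
  have hBm : Measurable fun z : (ℝ ∙ e)ᗮ => (∫⁻ t : ℝ, ‖f ((z : E) + t • e)‖ₑ) ^ 2 :=
    (Measurable.lintegral_prod_right' (f := fun p : (ℝ ∙ e)ᗮ × ℝ => ‖f ((p.1 : E) + p.2 • e)‖ₑ)
      (by fun_prop)).pow_const 2
  have hpt : ∀ᵐ z : (ℝ ∙ e)ᗮ, ENNReal.ofReal (2 * δ) *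
      ∫⁻ r, ‖lineLaplace δ (fun t => f ((z : E) + t • e)) r‖ₑ ^ 2 ≤
      ‖∫ t : ℝ, f ((z : E) + t • e)‖ₑ ^ 2 + ENNReal.ofReal (δ * (8 * R + 4 * R ^ 2)) *
        (∫⁻ t : ℝ, ‖f ((z : E) + t • e)‖ₑ) ^ 2 := by
    filter_upwards [ae_integrable_line he hf] with z hz
    refine (lintegral_enorm_sq_lineLaplace_le hR hz (eq_zero_of_le_abs he hfs z) hδ).trans ?_
    have hAB : ‖∫ t : ℝ, f ((z : E) + t • e)‖ₑ ≤ ∫⁻ t : ℝ, ‖f ((z : E) + t • e)‖ₑ :=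
      enorm_integral_le_lintegral_enorm _
    set A := ‖∫ t : ℝ, f ((z : E) + t • e)‖ₑ
    set B := ∫⁻ t : ℝ, ‖f ((z : E) + t • e)‖ₑ
    set c := ENNReal.ofReal (2 * R * δ) with hc
    calc (A + c * B) ^ 2 + ENNReal.ofReal (4 * R * δ) * B ^ 2
        = A ^ 2 + (2 * c * (A * B) + c ^ 2 * B ^ 2 + ENNReal.ofReal (4 * R * δ) * B ^ 2) := by ring
      _ ≤ A ^ 2 + (2 * c * (B * B) + c ^ 2 * B ^ 2 + ENNReal.ofReal (4 * R * δ) * B ^ 2) := by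
          gcongr
      _ = A ^ 2 + (2 * c + c ^ 2 + ENNReal.ofReal (4 * R * δ)) * B ^ 2 := by ring
      _ ≤ _ := by
          gcongr
          rw [hc, ← ENNReal.ofReal_pow (by positivity), ← ENNReal.ofReal_ofNat 2,
            ← ENNReal.ofReal_mul (by norm_num), ← ENNReal.ofReal_add (by positivity) (by positivity),
            ← ENNReal.ofReal_add (by positivity) (by positivity)]
          refine ENNReal.ofReal_le_ofReal ?_
          have : R ^ 2 * δ ^ 2 ≤ R ^ 2 * δ := by
            gcongr; nlinarith
          nlinarith
  refine (lintegral_mono_ae hpt).trans ?_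
  rw [lintegral_add_right _ (hBm.const_mul _), lintegral_const_mul _ hBm]
  refine add_le_add le_rfl ?_
  rw [ENNReal.ofReal_mul hδ.le, ENNReal.ofReal_mul (p := 8 * R + 4 * R ^ 2) (by positivity),
    mul_assoc, mul_assoc]
  gcongr
  exact lintegral_sq_lintegral_line_le he hfm hfs

theorem lintegral_enorm_sq_line_le (hR : 0 ≤ R) (he : ‖e‖ = 1) (hfm : Measurable f)
    (hf2 : MemLp f 2) (hfs : ∀ x, R ≤ ‖x‖ → f x = 0) {v v' : (ℝ ∙ e)ᗮ → ℝ → ℂ}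
    (hv : ∀ z t, HasDerivAt (v z) (v' z t) t) (hv' : ∀ z, Continuous (v' z)) {ε : ℝ} (hε : 0 ≤ ε)
    (hvε : ∀ z t, ‖z‖ ≤ R → |t| ≤ R → ‖v z t‖ ≤ ε)
    (hvε' : ∀ z t, ‖z‖ ≤ R → |t| ≤ R → ‖v' z t‖ ≤ ε) :
    ∫⁻ z : (ℝ ∙ e)ᗮ, ‖∫ t : ℝ, f ((z : E) + t • e)‖ₑ ^ 2 ≤
      2 * (∫⁻ z : (ℝ ∙ e)ᗮ, ‖∫ t : ℝ, f ((z : E) + t • e) * (1 + v z t)‖ₑ ^ 2) +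
        2 * (ENNReal.ofReal ((4 + 16 * R) * ε ^ 2) * ∫⁻ ξ, ‖𝓕 f ξ‖ₑ ^ 2 *
          ENNReal.ofReal (poissonSymbol 1 (inner ℝ e ξ))) := by
  have hf := hf2.integrable_of_eq_zero_of_le_norm hfs
  have hLm : Measurable fun z : (ℝ ∙ e)ᗮ =>
      ∫⁻ r, ‖lineLaplace 1 (fun t => f ((z : E) + t • e)) r‖ₑ ^ 2 := by
    have h1 : Measurable fun p : ((ℝ ∙ e)ᗮ × ℝ) × ℝ => (Real.exp (-(1 * p.2)) : ℂ) *
        f ((p.1.1 : E) + (p.1.2 + p.2) • e) := by fun_prop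
    have h2 : Measurable fun p : (ℝ ∙ e)ᗮ × ℝ =>
        lineLaplace 1 (fun t => f ((p.1 : E) + t • e)) p.2 :=
      (h1.stronglyMeasurable.integral_prod_right (ν := volume.restrict (Set.Ioi 0))).measurable
    exact (h2.enorm.pow_const 2).lintegral_prod_right'
  have hpt : ∀ᵐ z : (ℝ ∙ e)ᗮ, ‖∫ t : ℝ, f ((z : E) + t • e)‖ₑ ^ 2 ≤
      2 * ‖∫ t : ℝ, f ((z : E) + t • e) * (1 + v z t)‖ₑ ^ 2 +
      2 * ENNReal.ofReal ((4 + 16 * R) * ε ^ 2) *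
        ∫⁻ r, ‖lineLaplace 1 (fun t => f ((z : E) + t • e)) r‖ₑ ^ 2 := by
    filter_upwards [ae_integrable_line he hf] with z hz
    by_cases hzR : R ≤ ‖z‖
    · simp [eq_zero_of_le_norm he hfs z hzR]
    rw [not_le] at hzR
    have hs := eq_zero_of_le_abs he hfs z
    have hvc : Continuous (v z) :=
      continuous_iff_continuousAt.2 fun t => (hv z t).continuousAt
    have hvi : Integrable fun t : ℝ => f ((z : E) + t • e) * v z t := by
      refine (hz.norm.mul_const ε).mono' (hz.aestronglyMeasurable.mul hvc.aestronglyMeasurable)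
        (.of_forall fun t => ?_)
      by_cases ht : R ≤ |t|
      · simp [hs t ht]
      · rw [norm_mul]
        gcongr
        exact hvε z t hzR.le (not_le.1 ht).le
    have hsub : ∫ t : ℝ, f ((z : E) + t • e) = (∫ t : ℝ, f ((z : E) + t • e) * (1 + v z t)) -
        ∫ t : ℝ, f ((z : E) + t • e) * v z t := by
      simp_rw [mul_add, mul_one]
      rw [integral_add hz hvi, add_sub_cancel_right]
    rw [hsub]
    calc _ ≤ (‖∫ t : ℝ, f ((z : E) + t • e) * (1 + v z t)‖ₑ +
          ‖∫ t : ℝ, f ((z : E) + t • e) * v z t‖ₑ) ^ 2 := by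
          gcongr; exact enorm_sub_le
      _ ≤ _ := add_sq_le_two_mul _ _
      _ ≤ _ := by
          rw [mul_assoc]
          gcongr
          exact enorm_sq_integral_mul_le hR (by fun_prop) hz hs (hv z) (hv' z) hε
            (fun t ht => hvε z t hzR.le ht) (fun t ht => hvε' z t hzR.le ht)
  refine (lintegral_mono_ae hpt).trans ?_
  rw [lintegral_add_right _ (hLm.const_mul _), lintegral_const_mul _ hLm,
    lintegral_lineLaplace 1 he hfm, lintegral_const_mul' _ _ (by norm_num),
    ← lintegral_enorm_sq_rayLaplace one_pos e hfm hf hf2, mul_assoc]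
  gcongr
  -- Plancherel at `δ = 1` carries the factor `2δ = 2`, which may be discarded here.
  refine le_mul_of_one_le_left' ?_
  rw [ENNReal.one_le_ofReal]; norm_num

theorem lintegral_enorm_sq_weighted_line_le (he : ‖e‖ = 1) (hfm : Measurable f)
    (hfs : ∀ x, R ≤ ‖x‖ → f x = 0) {u : (ℝ ∙ e)ᗮ → ℝ → ℂ} {M : ℝ}
    (hu : ∀ z t, ‖z‖ ≤ R → |t| ≤ R → ‖u z t‖ ≤ M) :
    ∫⁻ z : (ℝ ∙ e)ᗮ, ‖∫ t : ℝ, f ((z : E) + t • e) * u z t‖ₑ ^ 2 ≤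
      ENNReal.ofReal M ^ 2 * (ENNReal.ofReal (2 * R) * ∫⁻ x, ‖f x‖ₑ ^ 2) := by
  refine le_trans ?_ (mul_le_mul_right (lintegral_sq_lintegral_line_le he hfm hfs) _)
  rw [← lintegral_const_mul' _ _ (ENNReal.pow_ne_top ENNReal.ofReal_ne_top)]
  refine lintegral_mono fun z => ?_
  rw [← mul_pow, ← lintegral_const_mul' _ _ ENNReal.ofReal_ne_top]
  gcongr
  refine (enorm_integral_le_lintegral_enorm _).trans (lintegral_mono fun t => ?_)
  by_cases hz : R ≤ ‖z‖
  · simp [eq_zero_of_le_norm he hfs z hz]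
  by_cases ht : R ≤ |t|
  · simp [eq_zero_of_le_abs he hfs z t ht]
  rw [enorm_mul, mul_comm]
  gcongr
  rw [← ofReal_norm]
  exact ENNReal.ofReal_le_ofReal (hu z t (not_le.1 hz).le (not_le.1 ht).le)

end LineFamily

/-! ### Averaging over directions -/

section Stability

variable {E : Type*} [NormedAddCommGroup E] [InnerProductSpace ℝ E] [FiniteDimensional ℝ E]
  [MeasurableSpace E] [BorelSpace E] {R : ℝ} {f : E → ℂ}

theorem measurable_fourier (hf : Integrable f) : Measurable (𝓕 f) :=
  (VectorFourier.fourierIntegral_continuous Real.continuous_fourierChar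
    (by exact continuous_inner) hf).measurable

theorem measurable_enorm_sq_mul_poissonSymbol (hf : Integrable f) (δ : ℝ) :
    Measurable fun p : sphere (0 : E) 1 × E =>
      ‖𝓕 f p.2‖ₑ ^ 2 * ENNReal.ofReal (poissonSymbol δ (inner ℝ (p.1 : E) p.2)) := by
  have := measurable_fourier hf
  have := measurable_poissonSymbol δ
  fun_prop

theorem lintegral_toSphere_lintegral_poissonSymbol (hf : Integrable f) (δ : ℝ) :
    ∫⁻ ζ : sphere (0 : E) 1, (∫⁻ ξ, ‖𝓕 f ξ‖ₑ ^ 2 *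
        ENNReal.ofReal (poissonSymbol δ (inner ℝ (ζ : E) ξ))) ∂(volume : Measure E).toSphere =
      ∫⁻ ξ, ‖𝓕 f ξ‖ₑ ^ 2 * ∫⁻ ζ : sphere (0 : E) 1,
        ENNReal.ofReal (poissonSymbol δ (inner ℝ (ζ : E) ξ)) ∂(volume : Measure E).toSphere := by
  have := measurable_poissonSymbol δ
  rw [lintegral_lintegral_swap (measurable_enorm_sq_mul_poissonSymbol hf δ).aemeasurable]
  refine lintegral_congr fun ξ => ?_
  rw [lintegral_const_mul _ (by fun_prop)]

/-- Since `c` does not depend on `δ`, and the error is `δ` times a quantity finite for `f ∈ L²`, the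
error disappears as `δ → 0`. -/
theorem mul_sobolev_le_xray (hR : 0 ≤ R) (hfm : Measurable f)
    (hf2 : MemLp f 2) (hfs : ∀ x, R ≤ ‖x‖ → f x = 0) {c : ℝ≥0∞}
    (hc : ∀ δ : ℝ, 0 < δ → δ ≤ 1 → ∀ ξ : E,
      c * ENNReal.ofReal ((1 + (2 * Real.pi * ‖ξ‖) ^ 2) ^ (-(1 / 2) : ℝ)) ≤
      ∫⁻ ζ : sphere (0 : E) 1, ENNReal.ofReal (poissonSymbol δ (inner ℝ (ζ : E) ξ))
        ∂(volume : Measure E).toSphere) :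
    c * ∫⁻ ξ, ‖𝓕 f ξ‖ₑ ^ 2 *
        ENNReal.ofReal ((1 + (2 * Real.pi * ‖ξ‖) ^ 2) ^ (-(1 / 2) : ℝ)) ≤
      ∫⁻ ζ : sphere (0 : E) 1, (∫⁻ z : (ℝ ∙ (ζ : E))ᗮ,
        ‖∫ t : ℝ, f ((z : E) + t • (ζ : E))‖ₑ ^ 2) ∂(volume : Measure E).toSphere := by
  have hf := hf2.integrable_of_eq_zero_of_le_norm hfs
  have hFm := measurable_fourier hf
  set X := ∫⁻ ζ : sphere (0 : E) 1, (∫⁻ z : (ℝ ∙ (ζ : E))ᗮ,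
        ‖∫ t : ℝ, f ((z : E) + t • (ζ : E))‖ₑ ^ 2) ∂(volume : Measure E).toSphere with hX
  set T := ENNReal.ofReal ((8 * R + 4 * R ^ 2) * (2 * R)) * ∫⁻ x, ‖f x‖ₑ ^ 2 with hT
  have hTtop : T * (volume : Measure E).toSphere Set.univ ≠ ⊤ := by
    have : ∫⁻ x, ‖f x‖ₑ ^ 2 ≠ ⊤ := by
      rw [lintegral_enorm_sq]; exact ENNReal.pow_ne_top hf2.2.ne
    exact ENNReal.mul_ne_top (ENNReal.mul_ne_top ENNReal.ofReal_ne_top this) (measure_ne_top _ _)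
  have hδ : ∀ δ : ℝ, 0 < δ → δ ≤ 1 → c * ∫⁻ ξ, ‖𝓕 f ξ‖ₑ ^ 2 *
      ENNReal.ofReal ((1 + (2 * Real.pi * ‖ξ‖) ^ 2) ^ (-(1 / 2) : ℝ)) ≤
      X + ENNReal.ofReal δ * (T * (volume : Measure E).toSphere Set.univ) := by
    intro δ hδ hδ1
    calc _ = ∫⁻ ξ, c * (‖𝓕 f ξ‖ₑ ^ 2 *
          ENNReal.ofReal ((1 + (2 * Real.pi * ‖ξ‖) ^ 2) ^ (-(1 / 2) : ℝ))) :=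
          (lintegral_const_mul _ (by fun_prop)).symm
      _ ≤ ∫⁻ ξ, ‖𝓕 f ξ‖ₑ ^ 2 * ∫⁻ ζ : sphere (0 : E) 1,
          ENNReal.ofReal (poissonSymbol δ (inner ℝ (ζ : E) ξ)) ∂(volume : Measure E).toSphere := by
          refine lintegral_mono fun ξ => ?_
          rw [mul_left_comm]
          gcongr
          exact hc δ hδ hδ1 ξ
      _ = ∫⁻ ζ : sphere (0 : E) 1, (∫⁻ ξ, ‖𝓕 f ξ‖ₑ ^ 2 *
          ENNReal.ofReal (poissonSymbol δ (inner ℝ (ζ : E) ξ))) ∂(volume : Measure E).toSphere :=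
          (lintegral_toSphere_lintegral_poissonSymbol hf δ).symm
      _ ≤ ∫⁻ ζ : sphere (0 : E) 1, ((∫⁻ z : (ℝ ∙ (ζ : E))ᗮ,
            ‖∫ t : ℝ, f ((z : E) + t • (ζ : E))‖ₑ ^ 2) + ENNReal.ofReal δ * T)
            ∂(volume : Measure E).toSphere :=
          lintegral_mono fun ζ => lintegral_poissonSymbol_le hR (by simp) hfm hf2 hfs hδ hδ1
      _ = _ := by
          rw [lintegral_add_right _ measurable_const, lintegral_const, mul_assoc]
  have hlim : Filter.Tendsto (fun δ : ℝ => X + ENNReal.ofReal δ *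
      (T * (volume : Measure E).toSphere Set.univ)) (nhdsWithin 0 (Set.Ioi 0))
      (nhds (X + 0 * (T * (volume : Measure E).toSphere Set.univ))) := by
    refine tendsto_const_nhds.add (ENNReal.Tendsto.mul_const ?_ (Or.inr hTtop))
    have h1 : Filter.Tendsto ENNReal.ofReal (nhds 0) (nhds (ENNReal.ofReal 0)) :=
      ENNReal.continuous_ofReal.tendsto 0
    rw [ENNReal.ofReal_zero] at h1
    exact h1.mono_left nhdsWithin_le_nhds
  rw [zero_mul, add_zero] at hlim
  refine ge_of_tendsto hlim ?_
  filter_upwards [Ioc_mem_nhdsGT (zero_lt_one' ℝ)] with δ hδ'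
  exact hδ δ hδ'.1 hδ'.2

theorem xray_le_weighted (hR : 0 ≤ R) (hfm : Measurable f)
    (hf2 : MemLp f 2) (hfs : ∀ x, R ≤ ‖x‖ → f x = 0)
    {v v' : ℝ × E → ℂ} (hv : ∀ z t, HasDerivAt (fun t => v (t, z)) (v' (t, z)) t)
    (hv' : Continuous v') {ε : ℝ} (hε : 0 ≤ ε)
    (hvε : ∀ (z : E) t, ‖z‖ ≤ R → |t| ≤ R → ‖v (t, z)‖ ≤ ε)
    (hvε' : ∀ (z : E) t, ‖z‖ ≤ R → |t| ≤ R → ‖v' (t, z)‖ ≤ ε) {C : ℝ≥0∞}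
    (hC : ∀ ξ : E, ∫⁻ ζ : sphere (0 : E) 1, ENNReal.ofReal (poissonSymbol 1 (inner ℝ (ζ : E) ξ))
        ∂(volume : Measure E).toSphere
      ≤ C * ENNReal.ofReal ((1 + (2 * Real.pi * ‖ξ‖) ^ 2) ^ (-(1 / 2) : ℝ))) :
    ∫⁻ ζ : sphere (0 : E) 1, (∫⁻ z : (ℝ ∙ (ζ : E))ᗮ,
        ‖∫ t : ℝ, f ((z : E) + t • (ζ : E))‖ₑ ^ 2) ∂(volume : Measure E).toSphere ≤
      2 * (∫⁻ ζ : sphere (0 : E) 1, (∫⁻ z : (ℝ ∙ (ζ : E))ᗮ,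
        ‖∫ t : ℝ, f ((z : E) + t • (ζ : E)) * (1 + v (t, z))‖ₑ ^ 2)
          ∂(volume : Measure E).toSphere) +
      2 * (ENNReal.ofReal ((4 + 16 * R) * ε ^ 2) * (C * ∫⁻ ξ, ‖𝓕 f ξ‖ₑ ^ 2 *
        ENNReal.ofReal ((1 + (2 * Real.pi * ‖ξ‖) ^ 2) ^ (-(1 / 2) : ℝ)))) := by
  have hf := hf2.integrable_of_eq_zero_of_le_norm hfs
  have hFm := measurable_fourier hf
  have hm : Measurable fun ζ : sphere (0 : E) 1 => ∫⁻ ξ, ‖𝓕 f ξ‖ₑ ^ 2 *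
      ENNReal.ofReal (poissonSymbol 1 (inner ℝ (ζ : E) ξ)) :=
    (measurable_enorm_sq_mul_poissonSymbol hf 1).lintegral_prod_right'
  refine (lintegral_mono fun ζ : sphere (0 : E) 1 => lintegral_enorm_sq_line_le hR
    (e := (ζ : E)) (by simp) hfm hf2 hfs (v := fun z t => v (t, z)) (v' := fun z t => v' (t, z))
    (fun z t => hv z t) (fun z => by fun_prop) hε (fun z t => hvε z t)
    (fun z t => hvε' z t)).trans ?_
  rw [lintegral_add_right _ ((hm.const_mul _).const_mul _), lintegral_const_mul' _ _ (by norm_num),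
    lintegral_const_mul _ (hm.const_mul _), lintegral_const_mul _ hm,
    lintegral_toSphere_lintegral_poissonSymbol hf, ← lintegral_const_mul C (by fun_prop)]
  gcongr ?_ + 2 * (_ * ?_)
  · exact le_rfl
  refine lintegral_mono fun ξ => ?_
  rw [mul_left_comm]
  gcongr
  exact hC ξ

end Stability

/-! ### Translation of the norms and the weight condition -/

namespace WeightedXray

theorem bundleL2Norm_eq {d : ℕ} {F G : (ζ : sphere (0 : Space d) 1) → (ℝ ∙ (ζ : Space d))ᗮ → ℂ}
    (h : ∀ ζ, F ζ =ᵐ[volume] G ζ) : bundleL2Norm F = bundleL2Norm G := by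
  unfold bundleL2Norm
  congr 1
  refine lintegral_congr fun ζ => lintegral_congr_ae ?_
  filter_upwards [h ζ] with z hz
  rw [hz]

theorem bundleL2Norm_sq {d : ℕ} (F : (ζ : sphere (0 : Space d) 1) → (ℝ ∙ (ζ : Space d))ᗮ → ℂ) :
    bundleL2Norm F ^ 2 = ∫⁻ ζ, (∫⁻ z : (ℝ ∙ (ζ : Space d))ᗮ, ‖F ζ z‖ₑ ^ 2)
      ∂(volume : Measure (Space d)).toSphere := by
  unfold bundleL2Norm
  rw [← ENNReal.rpow_natCast, ← ENNReal.rpow_mul]; norm_num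

theorem sobolevNorm_neg_half_sq {d : ℕ} (f : Lp ℂ 2 (volume : Measure (Space d))) :
    sobolevNorm (-1 / 2) f ^ 2 = ∫⁻ ξ, ‖(𝓕 f : Lp ℂ 2 (volume : Measure (Space d))) ξ‖ₑ ^ 2 *
      ENNReal.ofReal ((1 + (2 * Real.pi * ‖ξ‖) ^ 2) ^ (-(1 / 2) : ℝ)) := by
  unfold sobolevNorm
  rw [← lintegral_enorm_sq]
  refine lintegral_congr fun ξ => ?_
  have h0 : 0 ≤ (1 + (2 * Real.pi * ‖ξ‖) ^ 2 : ℝ) := by positivity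
  rw [enorm_mul, mul_pow, mul_comm, ← ofReal_norm (Complex.ofReal _), Complex.norm_real, Real.norm_eq_abs,
    abs_of_nonneg (by positivity), ← ENNReal.ofReal_pow (by positivity), ← Real.rpow_mul_natCast h0]
  norm_num

theorem norm_le_of_mixedPartial_le {d : ℕ} {g : ℝ × Space d → ℂ} {p : ℝ × Space d} {ε : ℝ}
    (h : ∀ k : ℕ, k ≤ 1 → ∀ i : Fin k → Fin (d + 1), ‖mixedPartial i g p‖ ≤ ε) :
    ‖g p‖ ≤ ε ∧ ‖fderiv ℝ g p (1, 0)‖ ≤ ε := by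
  constructor
  · simpa [mixedPartial] using h 0 zero_le_one Fin.elim0
  · simpa [mixedPartial, coordDir, iteratedFDeriv_one_apply] using h 1 le_rfl fun _ => 0

end WeightedXray

/-! ### Absorption and conclusion -/

open WeightedXray in
theorem weighted_xray_stability (d : ℕ) (hd : 2 ≤ d) {R : ℝ} (hR : 0 ≤ R) :
    ∃ ε : ℝ, 0 < ε ∧ ∃ C : ℝ, 0 < C ∧
      ∀ w : ℝ × Space d → ℂ, ContDiff ℝ 1 w →
        (∀ t z, |t| ≤ R → ‖z‖ ≤ R →
          ‖w (t, z) - 1‖ ≤ ε ∧ ‖fderiv ℝ (fun p => w p - 1) (t, z) (1, 0)‖ ≤ ε) →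
        ∀ f : Lp ℂ 2 (volume : Measure (Space d)), (∀ᵐ x, x ∉ ball 0 R → f x = 0) →
          bundleL2Norm (xray w f) < ⊤ ∧
          sobolevNorm (-1 / 2) f ≤ ENNReal.ofReal C * bundleL2Norm (xray w f) := by
  have hfr : 2 ≤ Module.finrank ℝ (Space d) := by simpa using hd
  obtain ⟨c, hc0, hc⟩ := exists_le_lintegral_toSphere_poissonSymbol hfr
  obtain ⟨K, hKtop, hK⟩ := exists_lintegral_toSphere_poissonSymbol_one_le hfr
  -- The lower and upper bounds for the spherical mean are compared at `δ = 1`, `ξ = 0`.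
  have hctop : c ≠ ⊤ := by
    rintro rfl
    have h1 := (hc 1 one_pos le_rfl 0).trans (hK 0)
    simp [hKtop] at h1
  obtain ⟨k, rfl⟩ : ∃ k : NNReal, K = k := ⟨K.toNNReal, (ENNReal.coe_toNNReal hKtop).symm⟩
  obtain ⟨a, rfl⟩ : ∃ a : NNReal, c = a := ⟨c.toNNReal, (ENNReal.coe_toNNReal hctop).symm⟩
  have ha : 0 < (a : ℝ) := by
    have : a ≠ 0 := by rintro rfl; simp at hc0
    positivity
  -- Chosen so that the perturbation costs at most `(a/2) H`; then `(a/2) H ≤ 2W`, whence the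
  -- constant `2/√a`. The `+ 1` avoids dividing by `k`.
  set ε : ℝ := √((a : ℝ) / (4 * (4 + 16 * R) * (k + 1))) with hεdef
  have hε : 0 < ε := Real.sqrt_pos.2 (by positivity)
  refine ⟨ε, hε, 2 / √a, by positivity, fun w hw hwε f hf => ?_⟩
  -- A measurable representative vanishing everywhere off the ball, as the estimates on individual
  -- lines require.
  set F : Space d → ℂ := (ball 0 R).indicator f with hFdef
  have hFm : Measurable F := (Lp.stronglyMeasurable f).measurable.indicator measurableSet_ball
  have hFf : F =ᵐ[volume] f := by
    filter_upwards [hf] with x hx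
    by_cases h : x ∈ ball 0 R
    · simp [hFdef, h]
    · rw [hx h, hFdef, Set.indicator_of_notMem h]
  have hF2 : MemLp F 2 := (Lp.memLp f).ae_eq hFf.symm
  have hFs : ∀ x, R ≤ ‖x‖ → F x = 0 := fun x hx => by
    rw [hFdef, Set.indicator_of_notMem (by simpa using hx)]
  have hFi := hF2.integrable_of_eq_zero_of_le_norm hFs
  have hfF : f = hF2.toLp F := by
    refine Lp.ext (hFf.symm.trans hF2.coeFn_toLp.symm)
  set H := ∫⁻ ξ, ‖𝓕 F ξ‖ₑ ^ 2 *
    ENNReal.ofReal ((1 + (2 * Real.pi * ‖ξ‖) ^ 2) ^ (-(1 / 2) : ℝ)) with hH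
  have hsob : sobolevNorm (-1 / 2) f ^ 2 = H := by
    rw [sobolevNorm_neg_half_sq, hH]
    refine lintegral_congr_ae ?_
    have := coeFn_fourier_toLp hFi hF2
    rw [← hfF] at this
    filter_upwards [this] with ξ hξ
    rw [hξ]
  have hL2 : ∫⁻ x, ‖F x‖ₑ ^ 2 ≠ ⊤ := by
    rw [lintegral_enorm_sq]; exact ENNReal.pow_ne_top hF2.2.ne
  -- Absorbing `H` into the left side is only legitimate when `H` is finite.
  have hHtop : H ≠ ⊤ := by
    rw [← lintegral_enorm_sq_fourier hFi hF2] at hL2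
    refine ne_top_of_le_ne_top hL2 (lintegral_mono fun ξ => mul_le_of_le_one_right' ?_)
    rw [ENNReal.ofReal_le_one]
    exact Real.rpow_le_one_of_one_le_of_nonpos (by nlinarith [sq_nonneg (2 * Real.pi * ‖ξ‖)])
      (by norm_num)
  have hxr : bundleL2Norm (xray w f) = bundleL2Norm (xray w F) := by
    refine bundleL2Norm_eq fun ζ => ?_
    filter_upwards [ae_orthogonal_ae_line (e := (ζ : Space d)) (by simp) hFf] with z hz
    refine integral_congr_ae ?_
    filter_upwards [hz] with t ht
    rw [ht]
  set v : ℝ × Space d → ℂ := fun p => w p - 1 with hv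
  have hvd : ContDiff ℝ 1 v := hw.sub contDiff_const
  set W := ∫⁻ ζ : sphere (0 : Space d) 1, (∫⁻ z : (ℝ ∙ (ζ : Space d))ᗮ,
    ‖∫ t : ℝ, F ((z : Space d) + t • (ζ : Space d)) * (1 + v (t, z))‖ₑ ^ 2)
      ∂(volume : Measure (Space d)).toSphere with hW
  have hWeq : bundleL2Norm (xray w f) ^ 2 = W := by
    rw [hxr, bundleL2Norm_sq, hW]
    simp only [xray, hv, add_sub_cancel]
  have hWtop : W < ⊤ := by
    refine (lintegral_mono fun ζ : sphere (0 : Space d) 1 => lintegral_enorm_sq_weighted_line_le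
      (e := (ζ : Space d)) (by simp) hFm hFs (u := fun z t => 1 + v (t, z)) (M := 1 + ε)
      fun z t hz ht => ?_).trans_lt ?_
    · refine (norm_add_le _ _).trans ?_
      rw [norm_one]
      have := (hwε t z ht hz).1
      gcongr
    · rw [lintegral_const]
      have := measure_lt_top (volume : Measure (Space d)).toSphere Set.univ
      finiteness
  have h1 : a * H ≤ 2 * W + 2 * (ENNReal.ofReal ((4 + 16 * R) * ε ^ 2) * (k * H)) := by
    refine (mul_sobolev_le_xray hR hFm hF2 hFs hc).trans
      (xray_le_weighted hR hFm hF2 hFs (v := v) (v' := fun p => fderiv ℝ v p (1, 0))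
        (fun z t => ?_) ?_ hε.le (fun z t hz ht => (hwε t z ht hz).1)
        (fun z t hz ht => (hwε t z ht hz).2) hK)
    · have h2 : HasFDerivAt v (fderiv ℝ v (t, z)) (t, z) :=
        (hvd.differentiable one_ne_zero _).hasFDerivAt
      exact h2.comp_hasDerivAt t ((hasDerivAt_id t).prodMk (hasDerivAt_const t z))
    · exact (hvd.continuous_fderiv one_ne_zero).clm_apply continuous_const
  have h2 : H ≤ ENNReal.ofReal (2 / √a) ^ 2 * W := by
    obtain ⟨y, hy⟩ : ∃ y : NNReal, H = y := ⟨H.toNNReal, (ENNReal.coe_toNNReal hHtop).symm⟩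
    obtain ⟨x, hx⟩ : ∃ x : NNReal, W = x := ⟨W.toNNReal, (ENNReal.coe_toNNReal hWtop.ne).symm⟩
    rw [hy, hx] at h1 ⊢
    have hcoe : ∀ x : NNReal, (x : ℝ≥0∞) = ENNReal.ofReal x := fun x =>
      (ENNReal.ofReal_coe_nnreal).symm
    rw [hcoe, hcoe, hcoe, hcoe, ← ENNReal.ofReal_ofNat, ← ENNReal.ofReal_mul (by positivity),
      ← ENNReal.ofReal_mul (by positivity), ← ENNReal.ofReal_mul (by positivity),
      ← ENNReal.ofReal_mul (by positivity), ← ENNReal.ofReal_mul (by positivity),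
      ← ENNReal.ofReal_add (by positivity) (by positivity),
      ENNReal.ofReal_le_ofReal_iff (by positivity)] at h1
    rw [hcoe, hcoe, ← ENNReal.ofReal_pow (by positivity), ← ENNReal.ofReal_mul (by positivity)]
    refine ENNReal.ofReal_le_ofReal ?_
    have hεk : (4 + 16 * R) * ε ^ 2 * (4 * (k + 1)) = a := by
      rw [hεdef, Real.sq_sqrt (by positivity)]; field_simp
    rw [div_pow, Real.sq_sqrt ha.le, div_mul_eq_mul_div, le_div_iff₀ ha]
    have h3 : 2 * ((4 + 16 * R) * ε ^ 2 * (k * y)) ≤ a / 2 * (y : ℝ) := by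
      have : 0 ≤ (4 + 16 * R) * ε ^ 2 * (y : ℝ) := by positivity
      nlinarith
    linarith
  constructor
  · refine lt_top_iff_ne_top.2 fun h => ?_
    rw [h] at hWeq
    simp [← hWeq] at hWtop
  · rw [← hsob, ← hWeq, ← mul_pow] at h2
    exact (ENNReal.pow_le_pow_left_iff two_ne_zero).1 h2

theorem theorem2p7 (d : ℕ) (hd : 2 ≤ d) (α₀ : ℝ) (hα₀ : 0 < α₀) (hα₀' : α₀ < 1) :
    ∃ ε : ℝ, 0 < ε ∧ ∃ C : ℝ, 0 < C ∧ ∃ N : ℕ,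
      ∀ w : ℝ × WeightedXray.Space d → ℂ, ContDiff ℝ ∞ w →
        (∀ k : ℕ, k ≤ N → ∀ i : Fin k → Fin (d + 1),
          ∀ (t : ℝ) (z : WeightedXray.Space d), t ^ 2 + (1 + ‖z‖ ^ 2) ≤ 4 * α₀ ^ (-2 : ℤ) →
            ‖WeightedXray.mixedPartial i (fun p => w p - 1) (t, z)‖ ≤ ε) →
        ∀ f : Lp ℂ 2 (volume : Measure (WeightedXray.Space d)),
          (∀ᵐ x : WeightedXray.Space d, x ∉ ball 0 ((α₀ ^ (-2 : ℤ) - 1) ^ (1 / 2 : ℝ)) → f x = 0) →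
          WeightedXray.bundleL2Norm (WeightedXray.xray w f) < ⊤ ∧
          WeightedXray.sobolevNorm (-1 / 2) f ≤
            ENNReal.ofReal C * WeightedXray.bundleL2Norm (WeightedXray.xray w f) := by
  have hα : 1 ≤ α₀ ^ (-2 : ℤ) := by
    rw [zpow_neg]
    exact (one_le_inv₀ (by positivity)).2 (by norm_cast; exact pow_le_one₀ hα₀.le hα₀'.le)
  have hR : 0 ≤ (α₀ ^ (-2 : ℤ) - 1) ^ (1 / 2 : ℝ) := Real.rpow_nonneg (by linarith) _
  have hR2 : ((α₀ ^ (-2 : ℤ) - 1) ^ (1 / 2 : ℝ)) ^ 2 = α₀ ^ (-2 : ℤ) - 1 := by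
    rw [← Real.sqrt_eq_rpow, Real.sq_sqrt (by linarith)]
  obtain ⟨ε, hε, C, hC, h⟩ := weighted_xray_stability d hd hR
  -- `N = 1` suffices. With `R² = α₀⁻² - 1`, the region `|t|, ‖z‖ ≤ R` satisfies `t² + 1 + ‖z‖² ≤
  -- 2α₀⁻² - 1`, well within the region where `w` is controlled.
  refine ⟨ε, hε, C, hC, 1, fun w hw hwε f hf => h w (hw.of_le (by simp)) (fun t z ht hz => ?_) f hf⟩
  refine WeightedXray.norm_le_of_mixedPartial_le fun k hk i => hwε k hk i t z ?_
  have h1 := sq_le_sq' (abs_le.1 ht).1 (abs_le.1 ht).2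
  have h2 := pow_le_pow_left₀ (norm_nonneg z) hz 2
  linarith
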